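/- **Theorem 1.1 (The upper bound).** All constants below are real, and $p$ denotes primes. Fix $\theta,\xi\in(0,1)$, $\kappa,\lambda_1,\lambda_2,B,K>0$, $\alpha,\widetilde B>0$, $L_1,L_2>0$ and $A>1$. Let $\mathcal D(\kappa,\lambda_1,\lambda_2,B,K)$ be the set of multiplicative functions $h:\mathbb N\to[0,\infty)$ such that * $\displaystyle\prod_{w\le p<z}(1-h(p))^{-1}\le\Big(\frac{\log z}{\log w}\Big)^{\kappa}\Big(1+\frac{K}{\log w}\Big)$ for all real $z>w>\max\{B,1\}$; * $h(p^e)\le B/p$ for all primes $p>B$ and integers $e\ge1$; * $h(p^e)\le p^{-e\lambda_1+\lambda_2}$ for all primes $p$ and integers $e\ge 1$. Let $f:\mathbb N\to[0,\infty)$ be such that for every $\epsilon>0$ there is $C>0$ with $$f(mn)\le f(m)\min\{A^{\Omega(n)},Cn^{\epsilon}\}\quad\text{for all coprime positive integers } m,n,$$ where $\Omega(n)$ is the number of prime factors of $n$ counted with multiplicity. Then there is a constant $C_0>0$, depending only on $\theta,\xi,\kappa,\lambda_1,\lambda_2,B,K,\alpha,\widetilde B,L_1,L_2,A$ and $f$,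 with the following property. Let $\mathcal A$ be an infinite set, and for each real $T\ge1$ let $\chi_T:\mathcal A\to[0,\infty)$ be a function with $\{a:\chi_T(a)>0\}$ finite, such that $\sum_{a\in\mathcal A}\chi_T(a)\to\infty$ as $T\to\infty$. Let $(c_a)_{a\in\mathcal A}$ be positive integers, let $M:[1,\infty)\to[1,\infty)$ be a function, and let $h_T\in\mathcal D(\kappa,\lambda_1,\lambda_2,B,K)$ for each $T\ge1$. Assume that for every $T\ge1$ and every positive integer $d\le M(T)^\theta$ one can write $$\sum_{a\in\mathcal A,\ d\mid c_a}\chi_T(a)=h_T(d)M(T)(1+\varepsilon_1)+\varepsilon_2,\qquad |\varepsilon_1|\le L_1\prod_{B<p\le M(T),\ p\nmid d}(1-h_T(p))^2,\quad |\varepsilon_2|\le L_2M(T)^{1-\xi},$$ and that $c_a\le\widetilde B\,M(T)^{\alpha}$ whenever $T\ge 1$ and $\chi_T(a)>0$. Then for all $T\ge1$ $$\sum_{a\in\mathcal A}\chi_T(a)f(c_a)\le C_0\,M(T)\prod_{B<p\le M(T)}(1-h_T(p))\sum_{1\le a\le M(T)}f(a)h_T(a).$$ -/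

import Mathlib

open Filter Finset
open scoped ArithmeticFunction.Omega

noncomputable section

/-- The class `𝒟(κ, λ₁, λ₂, B, K)` of density functions: non-negative multiplicative functions `h`
satisfying a sieve dimension bound and two bounds at prime powers. In the first bound
`w` is taken larger than `1`, so that `log w > 0`; this only matters when `B < 1`.
For `p > B` the second bound gives `h p < 1`, so that `1 - h p` is positive in the first one. -/
structure IsDensityFunction (κ lam₁ lam₂ B K : ℝ) (h : ArithmeticFunction ℝ) : Prop where
  nonneg : ∀ n, 0 ≤ h n
  isMultiplicative : h.IsMultiplicative
  prod_le : ∀ w z : ℝ, B < w → 1 < w → w < z →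
    ∏ p ∈ (range ⌈z⌉₊).filter (fun p : ℕ => p.Prime ∧ w ≤ (p : ℝ) ∧ (p : ℝ) < z), (1 - h p)⁻¹ ≤
      (Real.log z / Real.log w) ^ κ * (1 + K / Real.log w)
  prime_pow_le : ∀ p : ℕ, p.Prime → B < (p : ℝ) → ∀ e : ℕ, 1 ≤ e → h (p ^ e) ≤ B / p
  prime_pow_le_rpow : ∀ p : ℕ, p.Prime → ∀ e : ℕ, 1 ≤ e →
    h (p ^ e) ≤ (p : ℝ) ^ (-(e : ℝ) * lam₁ + lam₂)

/-- The class `ℳ(A, ε, C)` of non-negative arithmetic functions `f` with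
`f (m n) ≤ f m * min {A ^ Ω(n), C n ^ ε}` for all coprime positive integers `m`, `n`. -/
structure IsSubmultClass (A ε C : ℝ) (f : ArithmeticFunction ℝ) : Prop where
  nonneg : ∀ n, 0 ≤ f n
  mul_le : ∀ m n : ℕ, 0 < m → 0 < n → m.Coprime n →
    f (m * n) ≤ f m * min (A ^ Ω n) (C * (n : ℝ) ^ ε)

/-- A family `χ_T : 𝒜 → [0, ∞)`, `T ≥ 1`, of finitely supported weights whose total mass
tends to infinity with `T`. -/
structure IsWeightFamily {𝒜 : Type*} (χ : ℝ → 𝒜 → ℝ) : Prop where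
  nonneg : ∀ T : ℝ, 1 ≤ T → ∀ a, 0 ≤ χ T a
  finite : ∀ T : ℝ, 1 ≤ T → {a | 0 < χ T a}.Finite
  tendsto : Tendsto (fun T : ℝ => ∑ᶠ a, χ T a) atTop atTop

/-- `C_d(T)`, the sum of `χ_T a` over those `a` with `c_a` divisible by `d`. -/
def congruenceSum {𝒜 : Type*} (χ : ℝ → 𝒜 → ℝ) (c : 𝒜 → ℕ) (d : ℕ) (T : ℝ) : ℝ :=
  ∑ᶠ a ∈ {a | d ∣ c a}, χ T a

/-- The sequence `c`, weighted by `χ`, is equidistributed with constants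
`θ, ξ, κ, λ₁, λ₂, B, K`, functions `M` and `h_T`, and implied constants `L₁` and `L₂`:
for `T ≥ 1` and `1 ≤ d ≤ M(T) ^ θ` one has
`C_d(T) = h_T(d) M(T) (1 + ε₁) + ε₂`, where `|ε₁| ≤ L₁ ∏ (1 - h_T(p))²`, the product being over
the primes `B < p ≤ M(T)` not dividing `d`, and `|ε₂| ≤ L₂ M(T) ^ (1 - ξ)`. -/
structure IsEquidistributed (θ ξ κ lam₁ lam₂ B K L₁ L₂ : ℝ) {𝒜 : Type*} (χ : ℝ → 𝒜 → ℝ)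
    (c : 𝒜 → ℕ) (M : ℝ → ℝ) (h : ℝ → ArithmeticFunction ℝ) : Prop where
  one_le : ∀ T : ℝ, 1 ≤ T → 1 ≤ M T
  density : ∀ T : ℝ, 1 ≤ T → IsDensityFunction κ lam₁ lam₂ B K (h T)
  congruence : ∀ T : ℝ, 1 ≤ T → ∀ d : ℕ, 1 ≤ d → (d : ℝ) ≤ M T ^ θ →
    ∃ ε₁ ε₂ : ℝ, congruenceSum χ c d T = h T d * M T * (1 + ε₁) + ε₂ ∧
      |ε₁| ≤ L₁ * ∏ p ∈ (Icc 1 ⌊M T⌋₊).filter (fun p : ℕ => p.Prime ∧ B < (p : ℝ) ∧ ¬ p ∣ d),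
          (1 - h T p) ^ 2 ∧
      |ε₂| ≤ L₂ * M T ^ (1 - ξ)

end

/-!
The proof follows the method of Erdős, Wolke, Shiu and Nair-Tenenbaum for sums of multiplicative
functions over sparse sequences. Write `M = M(T)`. Each value `c = c a` is cut as `c = b * d`,
where `b` collects the prime powers of `c` with primes up to `M ^ η`, in increasing order of the
primes, as long as the product stays at most `M ^ x`, for small `x` and `η`. Thus `b` and `d` are
coprime, and the primes of `d` exceed those of `b` (`primePartBelow_le_or_exists_prime`,
`exists_prime_pow_or_class`).

* If all primes `q` of `d` are larger than `M ^ η`, then `d` has boundedly many prime factors, so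
  `f c ≪ f b`. The number of `a` with given `b` is bounded by a sieve over the primes up to
  `M ^ η` not dividing `b`, and summing `f b * h b ∏ (1 - h p)⁻¹`, the product being over `p ∣ b`,
  gives the main term.
* If the least prime `q` of `d` satisfies `M ^ (η / (s + 1)) < q ≤ M ^ (η / s)` and
  `b > M ^ (x / 2)`, then `f c ≤ A ^ O(s) * f b`, and the sieve up to `M ^ (η / (s + 1))` loses
  another factor `exp (O(s))`. Against this, `b` is large while all its primes are at most
  `M ^ (η / s)`, and Rankin's method with a shift `β ≍ s / log M` gains `exp (-C' * s)` with `C'`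
  as large as desired. Both cases are `exists_sum_class_le`, and the sum over `s` is a geometric
  series.
* In the remaining cases the power `q ^ v` exactly dividing `c` is large although `q ≤ M ^ η`, or
  `b` is large although all its primes are bounded. Then `c` is divisible by a prime power
  exceeding a fixed power of `M` whose prime is small, and the power saving of `h` at prime powers
  makes the total contribution smaller than the main term by a power of `M`
  (`exists_sum_prime_pow_dvd_le`, `exists_rpow_le_main`).

The sieve is that of Brun and Hooley (`exists_brunHooley_sieve`). Its coefficients are bounded by
`1`, which is what makes the relative errors `ε₁` summable: they contribute
`∏ ((1 - h p) ^ 2 + h p)`, of the order of `∏ (1 - h p)` (`exists_sieve_upper_bound`). Rankin's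
method is `sum_mul_prod_local_le` and `exists_rankin_bound`. The only nontrivial information on
primes used is `∑ log p / p ≤ log x + log 4` over `p ≤ x`. The bounds `h p ≤ B / p` then take the
place of the sieve dimension condition.
-/

/-! ### Reciprocal sums over primes -/

/-- A weak form of Mertens' first theorem, read off from the prime factorisation of `⌊x⌋!`. -/
theorem sum_log_div_prime_le {S : Finset ℕ} {x : ℝ} (hx : 1 ≤ x)
    (hS : ∀ p ∈ S, p.Prime ∧ (p : ℝ) ≤ x) :
    ∑ p ∈ S, Real.log p / p ≤ Real.log x + Real.log 4 := by
  set n := ⌊x⌋₊ with hn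
  have hn1 : 1 ≤ n := Nat.le_floor (by simpa using hx)
  have hn0 : (0 : ℝ) < n := by exact_mod_cast hn1
  have hnx : (n : ℝ) ≤ x := Nat.floor_le (by linarith)
  have hpn : ∀ p ∈ S, p ≤ n := fun p hp => Nat.le_floor (hS p hp).2
  have hdvd : (∏ p ∈ S, p ^ (n / p)) ∣ n.factorial := by
    refine Finset.prod_dvd_of_isRelPrime ?_ ?_
    · intro p hp q hq hpq
      exact Nat.coprime_iff_isRelPrime.mp (Nat.Coprime.pow _ _
        ((Nat.coprime_primes (hS p hp).1 (hS q hq).1).2 hpq))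
    · intro p hp
      have h1 : p ^ (n / p) ∣ (p * (n / p)).factorial := by
        rw [(hS p hp).1.pow_dvd_iff_le_factorization (Nat.factorial_ne_zero _),
          Nat.factorization_factorial_mul (hS p hp).1]
        omega
      exact h1.trans (Nat.factorial_dvd_factorial (Nat.mul_div_le n p))
  have hle : (∏ p ∈ S, p ^ (n / p) : ℕ) ≤ n ^ n :=
    (Nat.le_of_dvd (Nat.factorial_pos n) hdvd).trans (Nat.factorial_le_pow n)
  have hlog : ∑ p ∈ S, ((n / p : ℕ) : ℝ) * Real.log p ≤ n * Real.log n := by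
    have h2 : Real.log ((∏ p ∈ S, p ^ (n / p) : ℕ) : ℝ) ≤ Real.log ((n ^ n : ℕ) : ℝ) := by
      apply Real.log_le_log
      · exact_mod_cast Finset.prod_pos fun p hp => pow_pos (hS p hp).1.pos _
      · exact_mod_cast hle
    push_cast at h2
    rw [Real.log_prod (fun p hp => by have := (hS p hp).1.pos; positivity), Real.log_pow] at h2
    simpa [Real.log_pow] using h2
  have htheta : ∑ p ∈ S, Real.log p ≤ Real.log 4 * n := by
    refine le_trans ?_ (Chebyshev.theta_le_log4_mul_x (x := n) hn0.le)
    rw [Chebyshev.theta_eq_sum_Icc]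
    refine Finset.sum_le_sum_of_subset_of_nonneg ?_ ?_
    · intro p hp
      simp [(hS p hp).1, hpn p hp]
    · intro p hp _
      exact Real.log_natCast_nonneg p
  have hmain : n * ∑ p ∈ S, Real.log p / p ≤ n * (Real.log n + Real.log 4) := by
    calc n * ∑ p ∈ S, Real.log p / p = ∑ p ∈ S, ((n : ℝ) / p) * Real.log p := by
          rw [Finset.mul_sum]; exact Finset.sum_congr rfl fun p _ => by ring
      _ ≤ ∑ p ∈ S, (((n / p : ℕ) : ℝ) * Real.log p + Real.log p) := by
          refine Finset.sum_le_sum fun p hp => ?_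
          have hp0 : (0 : ℝ) < p := by exact_mod_cast (hS p hp).1.pos
          have h3 : (n : ℝ) / p ≤ ((n / p : ℕ) : ℝ) + 1 := by
            rw [div_le_iff₀ hp0]
            have := (Nat.lt_mul_of_div_lt (Nat.lt_succ_self (n / p)) (hS p hp).1.pos).le
            exact_mod_cast this
          nlinarith [Real.log_natCast_nonneg p]
      _ ≤ n * (Real.log n + Real.log 4) := by
          rw [Finset.sum_add_distrib]; linarith
  have := le_of_mul_le_mul_left hmain hn0
  have := Real.log_le_log hn0 hnx
  linarith

theorem sum_inv_prime_le {S : Finset ℕ} {x Y : ℝ} (hx : 1 ≤ x) (hY : 1 < Y)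
    (hS : ∀ p ∈ S, p.Prime ∧ (p : ℝ) ≤ x ∧ Y ≤ p) :
    ∑ p ∈ S, (1 : ℝ) / p ≤ (Real.log x + Real.log 4) / Real.log Y := by
  have hlY := Real.log_pos hY
  rw [le_div_iff₀ hlY, Finset.sum_mul]
  refine le_trans ?_ (sum_log_div_prime_le hx fun p hp => ⟨(hS p hp).1, (hS p hp).2.1⟩)
  refine Finset.sum_le_sum fun p hp => ?_
  have hp0 : (0 : ℝ) < p := by exact_mod_cast (hS p hp).1.pos
  rw [one_div_mul_eq_div]
  gcongr
  exact (hS p hp).2.2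

/-- The sum of the reciprocals of the primes up to `x` is smaller than any multiple of `log x`. -/
theorem exists_sum_inv_prime_le {τ : ℝ} (hτ : 0 < τ) :
    ∃ C : ℝ, 0 < C ∧ ∀ (S : Finset ℕ) (x : ℝ), 1 ≤ x → (∀ p ∈ S, p.Prime ∧ (p : ℝ) ≤ x) →
      ∑ p ∈ S, (1 : ℝ) / p ≤ τ * Real.log x + C := by
  set Y : ℝ := Real.exp (1 / τ) with hYdef
  have hY : 1 < Y := by rw [hYdef, Real.one_lt_exp_iff]; positivity
  refine ⟨⌈Y⌉₊ + τ * Real.log 4, by positivity, fun S x hx hS => ?_⟩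
  rw [← Finset.sum_filter_add_sum_filter_not S (fun p : ℕ => (p : ℝ) < Y)]
  have h1 : ∑ p ∈ S.filter (fun p : ℕ => (p : ℝ) < Y), (1 : ℝ) / p ≤ ⌈Y⌉₊ := by
    calc ∑ p ∈ S.filter (fun p : ℕ => (p : ℝ) < Y), (1 : ℝ) / p
        ≤ ∑ p ∈ S.filter (fun p : ℕ => (p : ℝ) < Y), (1 : ℝ) := by
          refine Finset.sum_le_sum fun p hp => ?_
          have : (1 : ℝ) ≤ p := by exact_mod_cast (hS p (Finset.mem_filter.1 hp).1).1.pos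
          exact (div_le_one (by linarith)).2 this
      _ ≤ ⌈Y⌉₊ := by
          rw [Finset.sum_const, nsmul_eq_mul, mul_one]
          have : (S.filter fun p : ℕ => (p : ℝ) < Y) ⊆ Finset.range ⌈Y⌉₊ := by
            intro p hp
            exact Finset.mem_range.2 (Nat.lt_ceil.2 (Finset.mem_filter.1 hp).2)
          exact_mod_cast (Finset.card_le_card this).trans (Finset.card_range _).le
  have h2 : ∑ p ∈ S.filter (fun p : ℕ => ¬ (p : ℝ) < Y), (1 : ℝ) / p ≤
      (Real.log x + Real.log 4) / Real.log Y := by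
    refine sum_inv_prime_le hx hY fun p hp => ?_
    obtain ⟨h, h'⟩ := Finset.mem_filter.1 hp
    exact ⟨(hS p h).1, (hS p h).2, not_lt.1 h'⟩
  have h3 : (Real.log x + Real.log 4) / Real.log Y = τ * Real.log x + τ * Real.log 4 := by
    rw [hYdef, Real.log_exp]; field_simp
  linarith

theorem sum_inv_sq_prime_le {S : Finset ℕ} (hS : ∀ p ∈ S, p.Prime) :
    ∑ p ∈ S, (1 : ℝ) / (p : ℝ) ^ 2 ≤ 2 := by
  have h := sum_Ioo_inv_sq_le (α := ℝ) 0 (S.sup id + 1)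
  norm_num at h
  refine le_trans ?_ h
  simp only [one_div]
  refine Finset.sum_le_sum_of_subset_of_nonneg ?_ fun _ _ _ => by positivity
  intro p hp
  exact Finset.mem_Ioo.2 ⟨(hS p hp).pos, Nat.lt_succ_of_le (Finset.le_sup (f := id) hp)⟩

/-! ### The Brun-Hooley sieve -/

/-- The inclusion-exclusion sum for `∏ p ∈ S, (1 - g p)`, cut off at subsets of size `k`. -/
noncomputable def truncatedSieve (k : ℕ) (S : Finset ℕ) (g : ℕ → ℝ) : ℝ :=
  ∑ t ∈ S.powerset.filter (fun t => t.card ≤ k), (-1) ^ t.card * ∏ p ∈ t, g p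

theorem truncatedSieve_zero (S : Finset ℕ) (g : ℕ → ℝ) : truncatedSieve 0 S g = 1 := by
  have : S.powerset.filter (fun t => t.card ≤ 0) = {∅} := by
    ext t
    simp only [Nat.le_zero, Finset.card_eq_zero, Finset.mem_filter, Finset.mem_powerset,
      Finset.mem_singleton]
    exact ⟨fun h => h.2, fun h => ⟨by simp [h], h⟩⟩
  rw [truncatedSieve, this]; simp

theorem truncatedSieve_empty (k : ℕ) (g : ℕ → ℝ) : truncatedSieve k ∅ g = 1 := by
  simp [truncatedSieve, Finset.filter_singleton]

theorem truncatedSieve_succ_insert (k : ℕ) {S : Finset ℕ} {p : ℕ} (hp : p ∉ S) (g : ℕ → ℝ) :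
    truncatedSieve (k + 1) (insert p S) g =
      truncatedSieve (k + 1) S g - g p * truncatedSieve k S g := by
  simp only [truncatedSieve, Finset.sum_filter]
  rw [Finset.sum_powerset_insert hp, sub_eq_add_neg, Finset.mul_sum, ← Finset.sum_neg_distrib]
  congr 1
  refine Finset.sum_congr rfl fun t ht => ?_
  have hpt : p ∉ t := fun h => hp (Finset.mem_powerset.1 ht h)
  rw [Finset.card_insert_of_notMem hpt, Finset.prod_insert hpt]
  by_cases h : t.card ≤ k
  · rw [if_pos h, if_pos (by omega)]; ring
  · rw [if_neg h, if_neg (by omega)]; ring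

/-- The Bonferroni inequalities, in the form of a two-sided bound. -/
theorem truncatedSieve_sub_prod_bounds (S : Finset ℕ) (g : ℕ → ℝ)
    (hg : ∀ p ∈ S, 0 ≤ g p ∧ g p ≤ 1) (k : ℕ) :
    0 ≤ (-1) ^ k * (truncatedSieve k S g - ∏ p ∈ S, (1 - g p)) ∧
      (-1) ^ k * (truncatedSieve k S g - ∏ p ∈ S, (1 - g p)) ≤
        (∑ p ∈ S, g p) ^ (k + 1) / (k + 1).factorial := by
  induction S using Finset.induction_on generalizing k with
  | empty => simp [truncatedSieve_empty]
  | insert p S hp ih =>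
    have ih := ih fun q hq => hg q (Finset.mem_insert_of_mem hq)
    obtain ⟨hp0, hp1⟩ := hg p (Finset.mem_insert_self p S)
    have hL : 0 ≤ ∑ q ∈ S, g q :=
      Finset.sum_nonneg fun q hq => (hg q (Finset.mem_insert_of_mem hq)).1
    rw [Finset.prod_insert hp, Finset.sum_insert hp]
    set V := ∏ q ∈ S, (1 - g q) with hV
    set L := ∑ q ∈ S, g q with hLdef
    have hV0 : 0 ≤ V := Finset.prod_nonneg fun q hq => by
      linarith [(hg q (Finset.mem_insert_of_mem hq)).2]
    have hV1 : V ≤ 1 := Finset.prod_le_one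
      (fun q hq => by linarith [(hg q (Finset.mem_insert_of_mem hq)).2])
      (fun q hq => by linarith [(hg q (Finset.mem_insert_of_mem hq)).1])
    cases k with
    | zero =>
      have h0 := ih 0
      simp only [truncatedSieve_zero, pow_zero, one_mul, zero_add, pow_one, Nat.factorial_one,
        Nat.cast_one, div_one] at h0 ⊢
      constructor
      · nlinarith
      · nlinarith
    | succ k =>
      have h0 := ih k
      have h1 := ih (k + 1)
      rw [truncatedSieve_succ_insert k hp]
      have key : (-1 : ℝ) ^ (k + 1) * (truncatedSieve (k + 1) S g - g p * truncatedSieve k S g -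
          (1 - g p) * V) = (-1) ^ (k + 1) * (truncatedSieve (k + 1) S g - V) +
            g p * ((-1) ^ k * (truncatedSieve k S g - V)) := by ring
      rw [key]
      refine ⟨add_nonneg h1.1 (mul_nonneg hp0 h0.1), ?_⟩
      refine (add_le_add h1.2 (mul_le_mul_of_nonneg_left h0.2 hp0)).trans ?_
      have hbern : L ^ (k + 2) + (k + 2) * (g p * L ^ (k + 1)) ≤ (g p + L) ^ (k + 2) := by
        rw [add_pow, Finset.sum_range_succ', Finset.sum_range_succ']
        have : 0 ≤ ∑ i ∈ Finset.range (k + 1), g p ^ (i + 1 + 1) * L ^ (k + 2 - (i + 1 + 1)) *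
            ((k + 2).choose (i + 1 + 1) : ℝ) := Finset.sum_nonneg fun i _ => by positivity
        generalize ∑ i ∈ Finset.range (k + 1), g p ^ (i + 1 + 1) * L ^ (k + 2 - (i + 1 + 1)) *
            ((k + 2).choose (i + 1 + 1) : ℝ) = R at this ⊢
        have e : k + 2 - (0 + 1) = k + 1 := by omega
        simp only [e]
        simp
        linarith
      have hf : ((k + 1 + 1).factorial : ℝ) = (k + 2) * (k + 1).factorial := by
        rw [Nat.factorial_succ (k + 1)]; push_cast; ring
      rw [hf]
      have hfp : (0 : ℝ) < (k + 1).factorial := by exact_mod_cast Nat.factorial_pos _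
      rw [show L ^ (k + 1 + 1) / ((k + 2) * ((k + 1).factorial : ℝ)) +
          g p * (L ^ (k + 1) / ((k + 1).factorial : ℝ)) =
          (L ^ (k + 2) + (k + 2) * (g p * L ^ (k + 1))) / ((k + 2) * ((k + 1).factorial : ℝ)) by
        field_simp]
      gcongr

/-- A product of truncated sieves over disjoint blocks expands into a single sieve supported on
a family `𝒯` of sets, whose total weight is controlled block by block. -/
theorem exists_prod_truncatedSieve (P : ℕ → Finset ℕ) (k : ℕ → ℕ) (ℓ : ℕ → ℝ) (u : ℕ → ℝ)
    (hP : ∀ i j, i ≠ j → Disjoint (P i) (P j)) (hu : ∀ j, 0 ≤ u j)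
    (hℓ : ∀ j, ∀ p ∈ P j, ℓ p ≤ u j) (J : ℕ) :
    ∃ 𝒯 : Finset (Finset ℕ),
      (∀ t ∈ 𝒯, t ⊆ (Finset.range J).biUnion P ∧ ∑ p ∈ t, ℓ p ≤ ∑ j ∈ Finset.range J, k j * u j) ∧
      ∀ g : ℕ → ℝ, ∑ t ∈ 𝒯, (-1) ^ t.card * ∏ p ∈ t, g p =
        ∏ j ∈ Finset.range J, truncatedSieve (k j) (P j) g := by
  induction J with
  | zero => exact ⟨{∅}, by simp, by simp⟩
  | succ J ih =>
    obtain ⟨𝒯, h𝒯, hsum⟩ := ih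
    have hdisj : ∀ t ∈ 𝒯, ∀ r ⊆ P J, Disjoint t r := by
      intro t ht r hr
      refine Finset.disjoint_of_subset_left (h𝒯 t ht).1 (Finset.disjoint_of_subset_right hr ?_)
      rw [Finset.disjoint_biUnion_left]
      exact fun i hi => hP i J (Finset.mem_range.1 hi).ne
    refine ⟨(𝒯 ×ˢ (P J).powerset.filter (fun t => t.card ≤ k J)).image (fun x => x.1 ∪ x.2),
      ?_, fun g => ?_⟩
    · intro t ht
      obtain ⟨⟨a, b⟩, hab, rfl⟩ := Finset.mem_image.1 ht
      simp only [Finset.mem_product, Finset.mem_filter, Finset.mem_powerset] at hab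
      obtain ⟨ha, hb, hbk⟩ := hab
      constructor
      · rw [Finset.range_add_one, Finset.biUnion_insert, Finset.union_comm]
        exact Finset.union_subset_union hb (h𝒯 a ha).1
      · rw [Finset.sum_union (hdisj a ha b hb), Finset.sum_range_succ]
        refine add_le_add (h𝒯 a ha).2 ?_
        calc ∑ p ∈ b, ℓ p ≤ b.card • u J :=
              Finset.sum_le_card_nsmul _ _ _ fun p hp => hℓ J p (hb hp)
          _ ≤ k J * u J := by
            rw [nsmul_eq_mul]
            exact mul_le_mul_of_nonneg_right (by exact_mod_cast hbk) (hu J)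
    · rw [Finset.sum_image, Finset.sum_product, Finset.prod_range_succ, ← hsum g, Finset.sum_mul]
      · refine Finset.sum_congr rfl fun a ha => ?_
        rw [truncatedSieve, Finset.mul_sum]
        refine Finset.sum_congr rfl fun b hb => ?_
        have hd := hdisj a ha b (Finset.mem_powerset.1 (Finset.mem_filter.1 hb).1)
        dsimp only
        rw [Finset.card_union_of_disjoint hd, Finset.prod_union hd, pow_add]
        ring
      · rintro ⟨a, b⟩ hab ⟨a', b'⟩ hab' h
        simp only [Finset.coe_product, Set.mem_prod, Finset.mem_coe, Finset.mem_filter,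
          Finset.mem_powerset] at hab hab' h
        have hb : ∀ a ∈ 𝒯, ∀ b ⊆ P J, (a ∪ b) ∩ P J = b := fun a ha b hb => by
          rw [Finset.union_inter_distrib_right, Finset.disjoint_iff_inter_eq_empty.1
            (hdisj a ha _ subset_rfl), Finset.empty_union, Finset.inter_eq_left.2 hb]
        have ha : ∀ a ∈ 𝒯, ∀ b ⊆ P J, (a ∪ b) \ P J = a := fun a ha b hb => by
          rw [Finset.union_sdiff_distrib, Finset.sdiff_eq_empty_iff_subset.2 hb, Finset.union_empty,
            Finset.sdiff_eq_self_of_disjoint (hdisj a ha _ subset_rfl)]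
        rw [Prod.mk.injEq]
        exact ⟨by rw [← ha a hab.1 b hab.2.1, h, ha a' hab'.1 b' hab'.2.1],
          by rw [← hb a hab.1 b hab.2.1, h, hb a' hab'.1 b' hab'.2.1]⟩

theorem sum_range_two_mul_mul_div_two_pow_le (J : ℕ) {v : ℝ} (hv : 0 ≤ v) :
    ∑ j ∈ Finset.range J, ((2 * j : ℕ) : ℝ) * (v / 2 ^ j) ≤ 4 * v := by
  have h : ∑ j ∈ Finset.range J, ((2 * j : ℕ) : ℝ) * (v / 2 ^ j) =
      4 * v - 4 * (J + 1) * (v / 2 ^ J) := by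
    induction J with
    | zero => simp
    | succ J ih => rw [Finset.sum_range_succ, ih]; push_cast; rw [pow_succ]; field_simp; ring
  rw [h]
  have : 0 ≤ 4 * ((J : ℝ) + 1) * (v / 2 ^ J) := by positivity
  linarith

theorem sum_range_odd_pow_div_factorial_le (J : ℕ) {r : ℝ} (hr : 0 ≤ r) :
    ∑ j ∈ Finset.range J, r ^ (2 * j + 1) / (2 * j + 1).factorial ≤ Real.exp r := by
  refine le_trans ?_ (Real.sum_le_exp_of_nonneg hr (2 * J))
  induction J with
  | zero => simp
  | succ J ih =>
    rw [Finset.sum_range_succ, show 2 * (J + 1) = 2 * J + 1 + 1 by ring, Finset.sum_range_succ,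
      Finset.sum_range_succ]
    have : 0 ≤ r ^ (2 * J) / (2 * J).factorial := by positivity
    linarith

theorem log_le_of_log_block {p y j : ℕ} (hp : p.Prime) (hpy : p ≤ y)
    (hj : Nat.log 2 (Nat.log p y) = j) :
    Real.log p ≤ Real.log y / 2 ^ j ∧ Real.log y / 2 ^ j ≤ 2 * Real.log p := by
  have hk : Nat.log p y ≠ 0 := (Nat.log_pos hp.one_lt hpy).ne'
  have h1 : 2 ^ j ≤ Nat.log p y := by rw [← hj]; exact Nat.pow_log_le_self 2 hk
  have h2 : Nat.log p y + 1 ≤ 2 ^ (j + 1) := by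
    rw [← hj]; exact Nat.lt_pow_succ_log_self (by norm_num) _
  have hy0 : y ≠ 0 := by have := hp.pos; omega
  have hlp : 0 ≤ Real.log p := Real.log_natCast_nonneg p
  have hp0 : (0 : ℝ) < p := by exact_mod_cast hp.pos
  constructor
  · rw [le_div_iff₀ (by positivity), mul_comm]
    have h3 : p ^ 2 ^ j ≤ y := (Nat.pow_le_pow_right hp.pos h1).trans (Nat.pow_log_le_self p hy0)
    have h4 := Real.log_le_log (by positivity) (show ((p : ℝ) ^ 2 ^ j) ≤ y by exact_mod_cast h3)
    rw [Real.log_pow] at h4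
    exact_mod_cast h4
  · rw [div_le_iff₀ (by positivity)]
    have h3 : y ≤ p ^ 2 ^ (j + 1) := ((Nat.lt_pow_succ_log_self hp.one_lt y).le).trans
      (Nat.pow_le_pow_right hp.pos h2)
    have h4 := Real.log_le_log (by exact_mod_cast Nat.pos_of_ne_zero hy0)
      (show (y : ℝ) ≤ (p : ℝ) ^ 2 ^ (j + 1) by exact_mod_cast h3)
    rw [Real.log_pow, pow_succ] at h4
    push_cast at h4
    linarith

/-- The primes in one dyadic range (on the scale `log log`) have bounded reciprocal sum. -/
theorem sum_inv_log_block_le {Q : Finset ℕ} {y : ℕ} (hQ : ∀ p ∈ Q, p.Prime ∧ p ≤ y) (j : ℕ) :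
    ∑ p ∈ Q.filter (fun p => Nat.log 2 (Nat.log p y) = j), (1 : ℝ) / p ≤ 6 := by
  rcases (Q.filter (fun p => Nat.log 2 (Nat.log p y) = j)).eq_empty_or_nonempty with h | ⟨q, hq⟩
  · rw [h]; norm_num
  set u := Real.log y / 2 ^ j with hu
  have hb : ∀ p ∈ Q.filter (fun p => Nat.log 2 (Nat.log p y) = j),
      p.Prime ∧ Real.log p ≤ u ∧ u ≤ 2 * Real.log p := fun p hp => by
    obtain ⟨hpQ, hpj⟩ := Finset.mem_filter.1 hp
    exact ⟨(hQ p hpQ).1, log_le_of_log_block (hQ p hpQ).1 (hQ p hpQ).2 hpj⟩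
  have hu2 : Real.log 2 ≤ u := by
    refine le_trans ?_ (hb q hq).2.1
    exact Real.log_le_log (by norm_num) (by exact_mod_cast (hb q hq).1.two_le)
  have hl2 : 0 < Real.log 2 := Real.log_pos (by norm_num)
  have hu0 : 0 < u := by linarith
  have h4 : Real.log 4 = 2 * Real.log 2 := by
    rw [show (4 : ℝ) = 2 ^ 2 by norm_num, Real.log_pow]; norm_num
  have := sum_inv_prime_le (S := Q.filter (fun p => Nat.log 2 (Nat.log p y) = j))
    (x := Real.exp u) (Y := Real.exp (u / 2)) (Real.one_le_exp hu0.le)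
    (Real.one_lt_exp_iff.2 (by linarith)) fun p hp => by
      obtain ⟨h1, h2, h3⟩ := hb p hp
      have hp0 : (0 : ℝ) < p := by exact_mod_cast h1.pos
      refine ⟨h1, ?_, ?_⟩
      · rwa [← Real.log_le_iff_le_exp hp0]
      · rw [← Real.le_log_iff_exp_le hp0]; linarith
  refine this.trans ?_
  rw [Real.log_exp, Real.log_exp, div_le_iff₀ (by linarith), h4]
  linarith

/-- The Brun-Hooley upper bound sieve: a combinatorial sieve of level `y ^ 4` for the primes in `Q`,
all at most `y`, whose main term has the expected order for densities `g p ≪ 1 / p`. The `j`-th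
block of primes, on which `y ^ (1 / 2 ^ (j + 1)) < p ≤ y ^ (1 / 2 ^ j)`, is treated by
inclusion-exclusion truncated at `2 * j` primes. -/
theorem exists_brunHooley_sieve {B D : ℝ} (hB : 0 < B) (hD : 0 < D) :
    ∃ C : ℝ, 0 < C ∧ ∀ (Q : Finset ℕ) (y : ℕ), 1 ≤ y → (∀ p ∈ Q, p.Prime ∧ p ≤ y) →
      ∃ 𝒯 : Finset (Finset ℕ),
        (∀ t ∈ 𝒯, t ⊆ Q ∧ ∏ p ∈ t, p ≤ y ^ 4) ∧
        (∀ (R : ℕ → Prop) [DecidablePred R], (if ∀ p ∈ Q, ¬ R p then (1 : ℝ) else 0) ≤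
          ∑ t ∈ 𝒯, (-1) ^ t.card * (if ∀ p ∈ t, R p then (1 : ℝ) else 0)) ∧
        ∀ g : ℕ → ℝ, (∀ p ∈ Q, 0 ≤ g p ∧ g p ≤ 1 ∧ g p ≤ B / p ∧ Real.exp (-(D / p)) ≤ 1 - g p) →
          ∑ t ∈ 𝒯, (-1) ^ t.card * ∏ p ∈ t, g p ≤ C * ∏ p ∈ Q, (1 - g p) := by
  refine ⟨Real.exp (Real.exp (6 * D) * Real.exp (6 * B)), Real.exp_pos _, fun Q y hy hQ => ?_⟩
  set P : ℕ → Finset ℕ := fun j => Q.filter (fun p => Nat.log 2 (Nat.log p y) = j) with hPdef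
  have hdisj : ∀ i j, i ≠ j → Disjoint (P i) (P j) := by
    intro i j hij
    rw [Finset.disjoint_left]
    intro p hp hp'
    exact hij ((Finset.mem_filter.1 hp).2.symm.trans (Finset.mem_filter.1 hp').2)
  have hly : 0 ≤ Real.log y := Real.log_natCast_nonneg y
  obtain ⟨𝒯, h𝒯, hsum⟩ := exists_prod_truncatedSieve P (fun j => 2 * j) (fun p => Real.log p)
    (fun j => Real.log y / 2 ^ j) hdisj (fun j => by positivity)
    (fun j p hp => by
      obtain ⟨hpQ, hpj⟩ := Finset.mem_filter.1 hp
      exact (log_le_of_log_block (hQ p hpQ).1 (hQ p hpQ).2 hpj).1) (y + 1)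
  have hmaps : ∀ p ∈ Q, Nat.log 2 (Nat.log p y) ∈ Finset.range (y + 1) := fun p _ => by
    rw [Finset.mem_range, Nat.lt_succ_iff]
    exact (Nat.log_le_self _ _).trans (Nat.log_le_self _ _)
  have hprod : ∀ F : ℕ → ℝ, ∏ j ∈ Finset.range (y + 1), ∏ p ∈ P j, F p = ∏ p ∈ Q, F p :=
    fun F => Finset.prod_fiberwise_of_maps_to hmaps F
  refine ⟨𝒯, fun t ht => ?_, fun R _ => ?_, fun g hg => ?_⟩
  · obtain ⟨h1, h2⟩ := h𝒯 t ht
    have htQ : t ⊆ Q := h1.trans (Finset.biUnion_subset.2 fun j _ => Finset.filter_subset _ _)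
    refine ⟨htQ, ?_⟩
    have h3 := h2.trans (sum_range_two_mul_mul_div_two_pow_le (y + 1) hly)
    have hp0 : ∀ p ∈ t, (p : ℝ) ≠ 0 := fun p hp => by
      exact_mod_cast (hQ p (htQ hp)).1.ne_zero
    rw [← Real.log_prod hp0] at h3
    have h4 : ∏ p ∈ t, (p : ℝ) ≤ (y : ℝ) ^ 4 := by
      rw [← Real.log_le_log_iff (Finset.prod_pos fun p hp => by
        exact_mod_cast (hQ p (htQ hp)).1.pos) (by positivity), Real.log_pow]
      exact_mod_cast h3
    have h5 : ((∏ p ∈ t, p : ℕ) : ℝ) ≤ ((y ^ 4 : ℕ) : ℝ) := by push_cast; exact h4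
    exact Nat.cast_le.1 h5
  · set g : ℕ → ℝ := fun p => if R p then 1 else 0 with hg
    have hg01 : ∀ p, 0 ≤ g p ∧ g p ≤ 1 := fun p => by
      simp only [hg]; split_ifs <;> norm_num
    have e1 : ∀ t : Finset ℕ, (if ∀ p ∈ t, R p then (1 : ℝ) else 0) = ∏ p ∈ t, g p := fun t => by
      rw [hg, Finset.prod_ite_zero, Finset.prod_const_one]
    have e2 : (if ∀ p ∈ Q, ¬ R p then (1 : ℝ) else 0) = ∏ p ∈ Q, (1 - g p) := by
      rw [← Finset.prod_const_one (s := Q), ← Finset.prod_ite_zero]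
      refine Finset.prod_congr rfl fun p _ => ?_
      simp only [hg]; split_ifs <;> norm_num
    simp only [e1, e2, hsum, ← hprod]
    refine Finset.prod_le_prod (fun j _ => Finset.prod_nonneg fun p _ => by linarith [hg01 p])
      fun j _ => ?_
    have := (truncatedSieve_sub_prod_bounds (P j) g (fun p _ => hg01 p) (2 * j)).1
    simp only [pow_mul, neg_one_sq, one_pow, one_mul] at this
    linarith
  · rw [hsum, ← hprod]
    set r := 6 * B with hr
    have hr0 : 0 ≤ r := by positivity
    have hblock : ∀ j ∈ Finset.range (y + 1), truncatedSieve (2 * j) (P j) g ≤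
        (∏ p ∈ P j, (1 - g p)) *
          Real.exp (Real.exp (6 * D) * (r ^ (2 * j + 1) / (2 * j + 1).factorial)) := by
      intro j _
      have hsub : ∀ p ∈ P j, p ∈ Q := fun p hp => (Finset.mem_filter.1 hp).1
      have hinv := sum_inv_log_block_le hQ j
      have h1 := (truncatedSieve_sub_prod_bounds (P j) g
        (fun p hp => ⟨(hg p (hsub p hp)).1, (hg p (hsub p hp)).2.1⟩) (2 * j)).2
      simp only [pow_mul (-1 : ℝ), neg_one_sq, one_pow, one_mul] at h1
      have hL : ∑ p ∈ P j, g p ≤ r := by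
        calc ∑ p ∈ P j, g p ≤ ∑ p ∈ P j, B * (1 / (p : ℝ)) :=
              Finset.sum_le_sum fun p hp => by
                rw [mul_one_div]; exact (hg p (hsub p hp)).2.2.1
          _ ≤ B * 6 := by rw [← Finset.mul_sum]; exact mul_le_mul_of_nonneg_left hinv hB.le
          _ = r := by rw [hr]; ring
      have hL0 : 0 ≤ ∑ p ∈ P j, g p := Finset.sum_nonneg fun p hp => (hg p (hsub p hp)).1
      have hV : Real.exp (-(6 * D)) ≤ ∏ p ∈ P j, (1 - g p) := by
        calc Real.exp (-(6 * D)) ≤ Real.exp (∑ p ∈ P j, -(D / p)) := by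
              apply Real.exp_le_exp.2
              rw [Finset.sum_neg_distrib, neg_le_neg_iff]
              calc ∑ p ∈ P j, D / (p : ℝ) = D * ∑ p ∈ P j, (1 : ℝ) / p := by
                    rw [Finset.mul_sum]; exact Finset.sum_congr rfl fun p _ => by ring
                _ ≤ D * 6 := mul_le_mul_of_nonneg_left hinv hD.le
                _ = 6 * D := by ring
          _ = ∏ p ∈ P j, Real.exp (-(D / p)) := Real.exp_sum _ _
          _ ≤ _ := Finset.prod_le_prod (fun p _ => (Real.exp_pos _).le)
              fun p hp => (hg p (hsub p hp)).2.2.2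
      set V := ∏ p ∈ P j, (1 - g p) with hVdef
      have hV0 : 0 < V := (Real.exp_pos _).trans_le hV
      have hVe : 1 ≤ V * Real.exp (6 * D) := by
        calc (1 : ℝ) = Real.exp (-(6 * D)) * Real.exp (6 * D) := by rw [← Real.exp_add]; simp
          _ ≤ _ := mul_le_mul_of_nonneg_right hV (Real.exp_pos _).le
      set w := r ^ (2 * j + 1) / ((2 * j + 1).factorial : ℝ) with hw
      have hw0 : 0 ≤ w := by positivity
      have h2 : (∑ p ∈ P j, g p) ^ (2 * j + 1) / ((2 * j + 1).factorial : ℝ) ≤ w := by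
        rw [hw]; gcongr
      calc truncatedSieve (2 * j) (P j) g ≤ V + w := by linarith
        _ ≤ V + (V * Real.exp (6 * D)) * w := by
            have := mul_le_mul_of_nonneg_right hVe hw0; linarith
        _ = V * (Real.exp (6 * D) * w + 1) := by ring
        _ ≤ V * Real.exp (Real.exp (6 * D) * w) :=
            mul_le_mul_of_nonneg_left (Real.add_one_le_exp _) hV0.le
    have hnn : ∀ j ∈ Finset.range (y + 1), 0 ≤ truncatedSieve (2 * j) (P j) g := by
      intro j _
      have hsub : ∀ p ∈ P j, p ∈ Q := fun p hp => (Finset.mem_filter.1 hp).1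
      have h1 := (truncatedSieve_sub_prod_bounds (P j) g
        (fun p hp => ⟨(hg p (hsub p hp)).1, (hg p (hsub p hp)).2.1⟩) (2 * j)).1
      simp only [pow_mul, neg_one_sq, one_pow, one_mul] at h1
      have : 0 ≤ ∏ p ∈ P j, (1 - g p) :=
        Finset.prod_nonneg fun p hp => by linarith [(hg p (hsub p hp)).2.1]
      linarith
    refine (Finset.prod_le_prod hnn hblock).trans ?_
    rw [Finset.prod_mul_distrib, mul_comm, ← Real.exp_sum, ← Finset.mul_sum]
    refine mul_le_mul_of_nonneg_right ?_ ?_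
    · apply Real.exp_le_exp.2
      exact mul_le_mul_of_nonneg_left (sum_range_odd_pow_div_factorial_le _ hr0) (Real.exp_pos _).le
    · exact Finset.prod_nonneg fun j _ => Finset.prod_nonneg fun p hp => by
        linarith [(hg p (Finset.mem_filter.1 hp).1).2.1]

/-! ### Density functions and the sieve bound -/

/-- `∏ (1 - h p)` over the primes `B < p ≤ x`. -/
noncomputable def sieveProduct (B x : ℝ) (h : ArithmeticFunction ℝ) : ℝ :=
  ∏ p ∈ (Finset.Icc 1 ⌊x⌋₊).filter (fun p : ℕ => p.Prime ∧ B < (p : ℝ)), (1 - h p)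

/-- The equidistribution hypothesis for a single value of `T`, over a finite index set `S`. -/
structure IsEquidistributedAt (θ ξ B L₁ L₂ : ℝ) {𝒜 : Type*} (S : Finset 𝒜) (χ : 𝒜 → ℝ)
    (c : 𝒜 → ℕ) (M : ℝ) (h : ArithmeticFunction ℝ) : Prop where
  one_le : 1 ≤ M
  nonneg : ∀ a ∈ S, 0 ≤ χ a
  congruence : ∀ d : ℕ, 1 ≤ d → (d : ℝ) ≤ M ^ θ →
    ∃ ε₁ ε₂ : ℝ, ∑ a ∈ S.filter (fun a => d ∣ c a), χ a = h d * M * (1 + ε₁) + ε₂ ∧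
      |ε₁| ≤ L₁ * ∏ p ∈ (Icc 1 ⌊M⌋₊).filter (fun p : ℕ => p.Prime ∧ B < (p : ℝ) ∧ ¬ p ∣ d),
          (1 - h p) ^ 2 ∧
      |ε₂| ≤ L₂ * M ^ (1 - ξ)

theorem exists_exp_neg_div_le_one_sub {B : ℝ} (hB : 0 < B) :
    ∃ D : ℝ, 0 < D ∧ ∀ (p : ℕ) (u : ℝ), B < p → u ≤ B / p → Real.exp (-(D / p)) ≤ 1 - u := by
  set m : ℝ := (⌊B⌋₊ : ℝ) + 1 with hm
  have hBm : B < m := Nat.lt_floor_add_one B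
  have hm0 : 0 < m := hB.trans hBm
  set ρ : ℝ := 1 - B / m with hρ
  have hρ0 : 0 < ρ := by rw [hρ, sub_pos, div_lt_one hm0]; exact hBm
  refine ⟨B / ρ, by positivity, fun p u hp hu => ?_⟩
  have hp0 : (0 : ℝ) < p := hB.trans hp
  have hmp : m ≤ p := by
    rw [hm]; exact_mod_cast Nat.succ_le_of_lt ((Nat.floor_lt hB.le).2 hp)
  set v := B / (p : ℝ) with hv
  have hvρ : ρ ≤ 1 - v := by
    rw [hρ, hv]; gcongr
  have hv0 : 0 ≤ v := by positivity
  have h1 : 1 / (1 - v) ≤ Real.exp (v / (1 - v)) := by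
    refine le_trans (le_of_eq ?_) (Real.add_one_le_exp _)
    have : 1 - v ≠ 0 := by linarith
    field_simp; ring
  have h2 : v / (1 - v) ≤ B / ρ / p := by
    rw [show B / ρ / (p : ℝ) = v / ρ from div_right_comm _ _ _]
    exact div_le_div_of_nonneg_left hv0 hρ0 hvρ
  have h3 : 1 / (1 - v) ≤ Real.exp (B / ρ / p) := h1.trans (Real.exp_le_exp.2 h2)
  rw [div_le_iff₀ (by linarith)] at h3
  rw [Real.exp_neg]
  have h4 : (Real.exp (B / ρ / p))⁻¹ ≤ 1 - v := by
    rw [inv_le_iff_one_le_mul₀ (Real.exp_pos _)]; linarith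
  linarith

namespace IsDensityFunction

variable {κ lam₁ lam₂ B K : ℝ} {h : ArithmeticFunction ℝ}

theorem apply_prime_le (hh : IsDensityFunction κ lam₁ lam₂ B K h) {p : ℕ} (hp : p.Prime)
    (hBp : B < p) : h p ≤ B / p := by
  simpa using hh.prime_pow_le p hp hBp 1 le_rfl

theorem apply_prime_lt_one (hB : 0 < B) (hh : IsDensityFunction κ lam₁ lam₂ B K h) {p : ℕ}
    (hp : p.Prime) (hBp : B < p) : h p < 1 :=
  (hh.apply_prime_le hp hBp).trans_lt ((div_lt_one (hB.trans hBp)).2 hBp)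

theorem prod_one_sub_pos (hB : 0 < B) (hh : IsDensityFunction κ lam₁ lam₂ B K h) {S : Finset ℕ}
    (hS : ∀ p ∈ S, p.Prime ∧ B < (p : ℝ)) : 0 < ∏ p ∈ S, (1 - h p) :=
  Finset.prod_pos fun p hp => by linarith [hh.apply_prime_lt_one hB (hS p hp).1 (hS p hp).2]

theorem prod_one_sub_le_of_subset (hB : 0 < B) (hh : IsDensityFunction κ lam₁ lam₂ B K h)
    {S T : Finset ℕ} (hST : S ⊆ T) (hT : ∀ p ∈ T, p.Prime ∧ B < (p : ℝ)) :
    ∏ p ∈ T, (1 - h p) ≤ ∏ p ∈ S, (1 - h p) := by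
  refine Finset.prod_le_prod_of_subset_of_le_one hST (fun p hp => ?_) fun p hp _ => ?_
  · linarith [hh.apply_prime_lt_one hB (hT p hp).1 (hT p hp).2]
  · linarith [hh.nonneg p]

end IsDensityFunction

theorem exp_neg_le_prod_one_sub {D : ℝ} {h : ℕ → ℝ} {S : Finset ℕ}
    (hS : ∀ p ∈ S, Real.exp (-(D / p)) ≤ 1 - h p) :
    Real.exp (-(D * ∑ p ∈ S, (1 : ℝ) / p)) ≤ ∏ p ∈ S, (1 - h p) := by
  calc Real.exp (-(D * ∑ p ∈ S, (1 : ℝ) / p)) = ∏ p ∈ S, Real.exp (-(D / p)) := by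
        rw [← Real.exp_sum, Finset.sum_neg_distrib, Finset.mul_sum]
        simp only [mul_one_div]
    _ ≤ _ := Finset.prod_le_prod (fun p _ => (Real.exp_pos _).le) hS

/-- The sieve product decays more slowly than any negative power of `x`. -/
theorem exists_le_sieveProduct {κ lam₁ lam₂ B K τ : ℝ} (hB : 0 < B) (hτ : 0 < τ) :
    ∃ C : ℝ, 0 < C ∧ ∀ (h : ArithmeticFunction ℝ), IsDensityFunction κ lam₁ lam₂ B K h →
      ∀ x : ℝ, 1 ≤ x → C * x ^ (-τ) ≤ sieveProduct B x h := by
  obtain ⟨D, hD, hDp⟩ := exists_exp_neg_div_le_one_sub hB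
  obtain ⟨C, hC, hCs⟩ := exists_sum_inv_prime_le (τ := τ / D) (by positivity)
  refine ⟨Real.exp (-(D * C)), Real.exp_pos _, fun h hh x hx => ?_⟩
  refine le_trans ?_ (exp_neg_le_prod_one_sub (D := D) fun p hp => ?_)
  · rw [Real.rpow_def_of_pos (by linarith), ← Real.exp_add, Real.exp_le_exp]
    have := hCs ((Finset.Icc 1 ⌊x⌋₊).filter (fun p : ℕ => p.Prime ∧ B < (p : ℝ))) x hx
      fun p hp => by
        simp only [Finset.mem_filter, Finset.mem_Icc] at hp
        exact ⟨hp.2.1, (Nat.le_floor_iff (by linarith)).1 hp.1.2⟩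
    have h2 := mul_le_mul_of_nonneg_left this hD.le
    have h3 : D * (τ / D * Real.log x + C) = τ * Real.log x + D * C := by field_simp
    rw [h3] at h2
    linarith
  · simp only [Finset.mem_filter] at hp
    exact hDp p _ hp.2.2 (hh.apply_prime_le hp.2.1 hp.2.2)

/-- The sieve bound for the elements divisible by `b` and by no prime in `Q`. The relative error
`ε₁` is harmless: weighted by `h`, it sums to `∏ ((1 - h p) ^ 2 + h p)`, which has the order of
magnitude of `∏ (1 - h p)`. -/
theorem exists_sieve_upper_bound {θ ξ κ lam₁ lam₂ B K L₁ L₂ : ℝ} (hB : 0 < B) (hL₁ : 0 < L₁) :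
    ∃ C : ℝ, 0 < C ∧ ∀ {𝒜 : Type*} (S : Finset 𝒜) (χ : 𝒜 → ℝ) (c : 𝒜 → ℕ) (M : ℝ)
      (h : ArithmeticFunction ℝ), IsDensityFunction κ lam₁ lam₂ B K h →
      IsEquidistributedAt θ ξ B L₁ L₂ S χ c M h →
      ∀ (b y : ℕ) (Q : Finset ℕ), 1 ≤ b → 1 ≤ y → (y : ℝ) ≤ M → ((b * y ^ 4 : ℕ) : ℝ) ≤ M ^ θ →
      (∀ p ∈ Q, p.Prime ∧ B < (p : ℝ) ∧ p ≤ y ∧ ¬ p ∣ b) →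
      ∑ a ∈ S.filter (fun a => b ∣ c a ∧ ∀ p ∈ Q, ¬ p ∣ c a), χ a ≤
        C * (M * h b * ∏ p ∈ Q, (1 - h p)) + L₂ * M ^ (1 - ξ) * (y : ℝ) ^ 4 := by
  obtain ⟨D, hD, hDp⟩ := exists_exp_neg_div_le_one_sub hB
  obtain ⟨C, hC, hsieve⟩ := exists_brunHooley_sieve hB hD
  refine ⟨C + L₁ * Real.exp (2 * (B ^ 2 * Real.exp D)), by positivity, ?_⟩
  intro 𝒜 S χ c M h hh hE b y Q hb hy hyM hbyM hQ
  obtain ⟨𝒯, h𝒯, hdet, hmain⟩ := hsieve Q y hy fun p hp => ⟨(hQ p hp).1, (hQ p hp).2.2.1⟩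
  have hM0 : 0 < M := by linarith [hE.one_le]
  have hlt : ∀ p ∈ Q, h p < 1 := fun p hp => hh.apply_prime_lt_one hB (hQ p hp).1 (hQ p hp).2.1
  have hexp : ∀ p ∈ Q, Real.exp (-(D / p)) ≤ 1 - h p := fun p hp =>
    hDp p _ (hQ p hp).2.1 (hh.apply_prime_le (hQ p hp).1 (hQ p hp).2.1)
  set V := ∏ p ∈ Q, (1 - h p) with hV
  have htp : ∀ t ∈ 𝒯, ∀ p ∈ t, p.Prime := fun t ht p hp => (hQ p ((h𝒯 t ht).1 hp)).1
  have hcop : ∀ t ∈ 𝒯, b.Coprime (∏ p ∈ t, p) := fun t ht =>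
    Nat.Coprime.prod_right fun p hp =>
      (((htp t ht p hp).coprime_iff_not_dvd).2 (hQ p ((h𝒯 t ht).1 hp)).2.2.2).symm
  have hhb : ∀ t ∈ 𝒯, h (b * ∏ p ∈ t, p) = h b * ∏ p ∈ t, h p := fun t ht => by
    rw [hh.isMultiplicative.map_mul_of_coprime (hcop t ht),
      hh.isMultiplicative.map_prod_of_prime t (htp t ht)]
  have hpos : ∀ t ∈ 𝒯, 0 < ∏ p ∈ t, p := fun t ht => Finset.prod_pos fun p hp => (htp t ht p hp).pos
  have hdvd : ∀ t ∈ 𝒯, ∀ n : ℕ, b * ∏ p ∈ t, p ∣ n ↔ b ∣ n ∧ ∀ p ∈ t, p ∣ n := by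
    intro t ht n
    constructor
    · intro hd
      exact ⟨dvd_of_mul_right_dvd hd, fun p hp =>
        (Finset.dvd_prod_of_mem _ hp).trans (dvd_of_mul_left_dvd hd)⟩
    · rintro ⟨h1, h2⟩
      exact (hcop t ht).mul_dvd_of_dvd_of_dvd h1
        (Finset.prod_primes_dvd n (fun p hp => (htp t ht p hp).prime) h2)
  -- The combinatorial sieve, summed over the weights.
  have hstep1 : ∑ a ∈ S.filter (fun a => b ∣ c a ∧ ∀ p ∈ Q, ¬ p ∣ c a), χ a ≤
      ∑ t ∈ 𝒯, (-1) ^ t.card * ∑ a ∈ S.filter (fun a => b * ∏ p ∈ t, p ∣ c a), χ a := by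
    calc ∑ a ∈ S.filter (fun a => b ∣ c a ∧ ∀ p ∈ Q, ¬ p ∣ c a), χ a
        = ∑ a ∈ S.filter (fun a => b ∣ c a), χ a * (if ∀ p ∈ Q, ¬ p ∣ c a then (1 : ℝ) else 0) := by
          rw [← Finset.filter_filter, Finset.sum_filter]
          simp
      _ ≤ ∑ a ∈ S.filter (fun a => b ∣ c a), χ a *
            ∑ t ∈ 𝒯, (-1) ^ t.card * (if ∀ p ∈ t, p ∣ c a then (1 : ℝ) else 0) :=
          Finset.sum_le_sum fun a ha => mul_le_mul_of_nonneg_left (hdet fun p => p ∣ c a)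
            (hE.nonneg a (Finset.mem_filter.1 ha).1)
      _ = ∑ t ∈ 𝒯, (-1) ^ t.card * ∑ a ∈ S.filter (fun a => b ∣ c a),
            (if ∀ p ∈ t, p ∣ c a then χ a else 0) := by
          simp only [Finset.mul_sum]
          rw [Finset.sum_comm]
          refine Finset.sum_congr rfl fun t _ => Finset.sum_congr rfl fun a _ => ?_
          split_ifs <;> ring
      _ = _ := by
          refine Finset.sum_congr rfl fun t ht => ?_
          rw [← Finset.sum_filter, Finset.filter_filter]
          congr 1
          refine Finset.sum_congr (Finset.filter_congr fun a _ => ?_) fun _ _ => rfl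
          exact (hdvd t ht (c a)).symm
  have hterm : ∀ t ∈ 𝒯, (-1) ^ t.card * ∑ a ∈ S.filter (fun a => b * ∏ p ∈ t, p ∣ c a), χ a ≤
      M * h b * ((-1) ^ t.card * ∏ p ∈ t, h p) +
      M * h b * L₁ * ((∏ p ∈ t, h p) * ∏ p ∈ Q \ t, (1 - h p) ^ 2) + L₂ * M ^ (1 - ξ) := by
    intro t ht
    obtain ⟨ε₁, ε₂, heq, h1, h2⟩ := hE.congruence (b * ∏ p ∈ t, p)
      (Nat.mul_pos hb (hpos t ht)) (le_trans (by
        exact_mod_cast Nat.mul_le_mul_left b (h𝒯 t ht).2) hbyM)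
    rw [heq, hhb t ht]
    have hsub : Q \ t ⊆ (Icc 1 ⌊M⌋₊).filter
        (fun p : ℕ => p.Prime ∧ B < (p : ℝ) ∧ ¬ p ∣ b * ∏ p ∈ t, p) := by
      intro p hp
      obtain ⟨hpQ, hpt⟩ := Finset.mem_sdiff.1 hp
      obtain ⟨q1, q2, q3, q4⟩ := hQ p hpQ
      simp only [Finset.mem_filter, Finset.mem_Icc]
      refine ⟨⟨q1.pos, Nat.le_floor (le_trans (by exact_mod_cast q3) hyM)⟩, q1, q2, fun hd => ?_⟩
      rcases (q1.dvd_mul).1 hd with hd | hd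
      · exact q4 hd
      · obtain ⟨r, hr, hpr⟩ := (q1.prime.dvd_finsetProd_iff _).1 hd
        rw [(Nat.prime_dvd_prime_iff_eq q1 (htp t ht r hr)).1 hpr] at hpt
        exact hpt hr
    have h3 : |ε₁| ≤ L₁ * ∏ p ∈ Q \ t, (1 - h p) ^ 2 := by
      refine h1.trans (mul_le_mul_of_nonneg_left ?_ hL₁.le)
      refine Finset.prod_le_prod_of_subset_of_le_one hsub (fun p _ => sq_nonneg _) fun p hp _ => ?_
      simp only [Finset.mem_filter] at hp
      have := hh.apply_prime_lt_one hB hp.2.1 hp.2.2.1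
      exact pow_le_one₀ (by linarith) (by linarith [hh.nonneg p])
    have hht : 0 ≤ ∏ p ∈ t, h p := Finset.prod_nonneg fun p _ => hh.nonneg p
    have hX : 0 ≤ M * h b * ∏ p ∈ t, h p := mul_nonneg (mul_nonneg hM0.le (hh.nonneg b)) hht
    have hs : ∀ z : ℝ, (-1) ^ t.card * z ≤ |z| := fun z => by
      refine (le_abs_self _).trans ?_
      rw [abs_mul, abs_pow, abs_neg, abs_one, one_pow, one_mul]
    have e1 := mul_le_mul_of_nonneg_left ((hs ε₁).trans h3) hX
    have e2 := (hs ε₂).trans h2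
    calc _ = M * h b * ((-1) ^ t.card * ∏ p ∈ t, h p) +
        (M * h b * ∏ p ∈ t, h p) * ((-1) ^ t.card * ε₁) + (-1) ^ t.card * ε₂ := by ring
      _ ≤ _ := by linarith
  have hcard : (𝒯.card : ℝ) ≤ (y : ℝ) ^ 4 := by
    have : 𝒯.card ≤ (Finset.Icc 1 (y ^ 4)).card := by
      refine Finset.card_le_card_of_injOn (fun t => ∏ p ∈ t, p) (fun t ht => ?_) ?_
      · exact Finset.mem_coe.2 (Finset.mem_Icc.2 ⟨hpos t ht, (h𝒯 t ht).2⟩)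
      · intro t ht t' ht' heq
        rw [← Nat.primeFactors_prod (htp t ht), ← Nat.primeFactors_prod (htp t' ht')]
        exact congrArg _ heq
    rw [Nat.card_Icc, Nat.add_sub_cancel] at this
    exact_mod_cast this
  have herr : ∑ t ∈ 𝒯, (∏ p ∈ t, h p) * ∏ p ∈ Q \ t, (1 - h p) ^ 2 ≤
      Real.exp (2 * (B ^ 2 * Real.exp D)) * V := by
    calc ∑ t ∈ 𝒯, (∏ p ∈ t, h p) * ∏ p ∈ Q \ t, (1 - h p) ^ 2
        ≤ ∑ t ∈ Q.powerset, (∏ p ∈ t, h p) * ∏ p ∈ Q \ t, (1 - h p) ^ 2 := by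
          refine Finset.sum_le_sum_of_subset_of_nonneg
            (fun t ht => Finset.mem_powerset.2 (h𝒯 t ht).1) fun t _ _ => ?_
          exact mul_nonneg (Finset.prod_nonneg fun p _ => hh.nonneg p)
            (Finset.prod_nonneg fun p _ => sq_nonneg _)
      _ = ∏ p ∈ Q, (h p + (1 - h p) ^ 2) := (Finset.prod_add _ _ _).symm
      _ ≤ ∏ p ∈ Q, (1 - h p) * Real.exp (B ^ 2 * Real.exp D * (1 / (p : ℝ) ^ 2)) := by
          refine Finset.prod_le_prod (fun p _ => add_nonneg (hh.nonneg p) (sq_nonneg _))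
            fun p hp => ?_
          have hp1 : (1 : ℝ) ≤ p := by exact_mod_cast (hQ p hp).1.pos
          have hu0 := hh.nonneg p
          have hu1 := hh.apply_prime_le (hQ p hp).1 (hQ p hp).2.1
          have h1u : 0 < 1 - h p := by linarith [hlt p hp]
          have hlow : Real.exp (-D) ≤ 1 - h p := by
            refine le_trans (Real.exp_le_exp.2 ?_) (hexp p hp)
            rw [neg_le_neg_iff]; exact div_le_self hD.le hp1
          have hsq : h p ^ 2 ≤ B ^ 2 * (1 / (p : ℝ) ^ 2) := by
            calc h p ^ 2 ≤ (B / p) ^ 2 := by gcongr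
              _ = _ := by ring
          have hone : 1 ≤ Real.exp D * (1 - h p) := by
            calc (1 : ℝ) = Real.exp D * Real.exp (-D) := by rw [← Real.exp_add]; simp
              _ ≤ _ := mul_le_mul_of_nonneg_left hlow (Real.exp_pos _).le
          have hq : h p ^ 2 ≤ (1 - h p) * (B ^ 2 * Real.exp D * (1 / (p : ℝ) ^ 2)) := by
            calc h p ^ 2 ≤ (B ^ 2 * (1 / (p : ℝ) ^ 2)) * 1 := by linarith
              _ ≤ (B ^ 2 * (1 / (p : ℝ) ^ 2)) * (Real.exp D * (1 - h p)) :=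
                  mul_le_mul_of_nonneg_left hone (by positivity)
              _ = _ := by ring
          have := mul_le_mul_of_nonneg_left
            (Real.add_one_le_exp (B ^ 2 * Real.exp D * (1 / (p : ℝ) ^ 2))) h1u.le
          nlinarith
      _ = V * Real.exp (B ^ 2 * Real.exp D * ∑ p ∈ Q, 1 / (p : ℝ) ^ 2) := by
          rw [Finset.prod_mul_distrib, ← Real.exp_sum, ← Finset.mul_sum]
      _ ≤ V * Real.exp (2 * (B ^ 2 * Real.exp D)) := by
          refine mul_le_mul_of_nonneg_left (Real.exp_le_exp.2 ?_)
            (Finset.prod_nonneg fun p hp => by linarith [hlt p hp])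
          rw [mul_comm]
          exact mul_le_mul_of_nonneg_right (sum_inv_sq_prime_le fun p hp => (hQ p hp).1)
            (by positivity)
      _ = _ := mul_comm _ _
  have hmain' := hmain h fun p hp => ⟨hh.nonneg p, (hlt p hp).le,
    hh.apply_prime_le (hQ p hp).1 (hQ p hp).2.1, hexp p hp⟩
  have hMb : 0 ≤ M * h b := mul_nonneg hM0.le (hh.nonneg b)
  -- `L₂` is not assumed nonnegative; the bound on `ε₂` forces it.
  have hL₂ : 0 ≤ L₂ * M ^ (1 - ξ) := by
    obtain ⟨_, ε₂, _, _, h2⟩ := hE.congruence b hb (le_trans (by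
      have : b ≤ b * y ^ 4 := Nat.le_mul_of_pos_right b (by positivity)
      exact_mod_cast this) hbyM)
    exact (abs_nonneg _).trans h2
  refine hstep1.trans ((Finset.sum_le_sum hterm).trans ?_)
  rw [Finset.sum_add_distrib, Finset.sum_add_distrib, ← Finset.mul_sum, ← Finset.mul_sum,
    Finset.sum_const, nsmul_eq_mul]
  have f1 := mul_le_mul_of_nonneg_left hmain' hMb
  have f2 := mul_le_mul_of_nonneg_left herr (mul_nonneg hMb hL₁.le)
  have f3 := mul_le_mul_of_nonneg_right hcard hL₂
  linarith

/-! ### Prime powers and Rankin's method -/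

/-- A power saving for density functions at prime powers. -/
theorem exists_apply_prime_pow_le (κ : ℝ) {lam₁ lam₂ B : ℝ} (K : ℝ) (hB : 0 < B) (hlam₁ : 0 < lam₁)
    (hlam₂ : 0 < lam₂) :
    ∃ δ : ℝ, 0 < δ ∧ δ ≤ 1 ∧ ∃ C : ℝ, 0 < C ∧ ∀ h : ArithmeticFunction ℝ,
      IsDensityFunction κ lam₁ lam₂ B K h → ∀ p : ℕ, p.Prime → ∀ e : ℕ, 1 ≤ e →
        h (p ^ e) ≤ C * (p : ℝ) ^ (-(δ * e)) := by
  set δ := min 1 (min (lam₁ / 2) (lam₁ / (2 * lam₂))) with hδdef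
  have hδ0 : 0 < δ := lt_min one_pos (lt_min (by positivity) (by positivity))
  have hδ1 : δ ≤ 1 := min_le_left _ _
  have hδ2 : δ ≤ lam₁ / 2 := (min_le_right _ _).trans (min_le_left _ _)
  have hδ3 : δ ≤ lam₁ / (2 * lam₂) := (min_le_right _ _).trans (min_le_right _ _)
  refine ⟨δ, hδ0, hδ1, 1 + B + B ^ (lam₂ + 1), by positivity, fun h hh p hp e he => ?_⟩
  have hp0 : (0 : ℝ) < p := by exact_mod_cast hp.pos
  have hp1 : (1 : ℝ) ≤ p := by exact_mod_cast hp.pos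
  have hBp : 0 < B ^ (lam₂ + 1) := by positivity
  have hr : 0 < (p : ℝ) ^ (-(δ * e)) := by positivity
  have he0 : (0 : ℝ) ≤ e := by positivity
  rcases le_or_gt (2 * lam₂) (e * lam₁) with hlarge | hsmall
  · calc h (p ^ e) ≤ (p : ℝ) ^ (-(e : ℝ) * lam₁ + lam₂) := hh.prime_pow_le_rpow p hp e he
      _ ≤ (p : ℝ) ^ (-(δ * e)) := by
          apply Real.rpow_le_rpow_of_exponent_le hp1
          nlinarith
      _ ≤ _ := by nlinarith
  · have hδe : δ * e ≤ 1 := by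
      rw [le_div_iff₀ (by positivity)] at hδ3
      have : (δ * e) * (2 * lam₂) ≤ 2 * lam₂ := by nlinarith
      nlinarith
    rcases lt_or_ge B p with hBlt | hBge
    · calc h (p ^ e) ≤ B / p := hh.prime_pow_le p hp hBlt e he
        _ = B * (p : ℝ) ^ (-1 : ℝ) := by rw [Real.rpow_neg_one]; rfl
        _ ≤ B * (p : ℝ) ^ (-(δ * e)) := by
            refine mul_le_mul_of_nonneg_left ?_ hB.le
            apply Real.rpow_le_rpow_of_exponent_le hp1
            linarith
        _ ≤ _ := by nlinarith
    · calc h (p ^ e) ≤ (p : ℝ) ^ (-(e : ℝ) * lam₁ + lam₂) := hh.prime_pow_le_rpow p hp e he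
        _ ≤ (p : ℝ) ^ ((lam₂ + 1) + -(δ * e)) := by
            apply Real.rpow_le_rpow_of_exponent_le hp1
            nlinarith
        _ = (p : ℝ) ^ (lam₂ + 1) * (p : ℝ) ^ (-(δ * e)) := Real.rpow_add hp0 _ _
        _ ≤ B ^ (lam₂ + 1) * (p : ℝ) ^ (-(δ * e)) := by
            refine mul_le_mul_of_nonneg_right ?_ hr.le
            exact Real.rpow_le_rpow hp0.le hBge (by linarith)
        _ ≤ _ := by nlinarith

/-- The weight of a prime power `p ^ e` in Rankin's method is `≪ r ^ e / p` for some `r < 1`,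
uniformly in the shift `β` as long as `p ^ β` stays bounded. The bound `h (p ^ e) ≤ B / p` serves
for bounded `e`, the bound `h (p ^ e) ≤ p ^ (-e * lam₁ + lam₂)` for larger `e`. -/
theorem exists_rankin_weight_le (κ : ℝ) {lam₁ lam₂ B A Cf c₁ : ℝ} (K : ℝ) (hB : 0 < B)
    (hlam₁ : 0 < lam₁) (hlam₂ : 0 < lam₂) (hA : 1 ≤ A) (hCf : 0 < Cf) (hc₁ : 0 ≤ c₁) :
    ∃ C : ℝ, 0 < C ∧ ∀ h : ArithmeticFunction ℝ, IsDensityFunction κ lam₁ lam₂ B K h →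
      ∀ β : ℝ, 0 ≤ β → β ≤ lam₁ / 8 → ∀ p : ℕ, p.Prime → β * Real.log p ≤ c₁ →
        ∀ e : ℕ, 1 ≤ e →
          h (p ^ e) * min (A ^ e) (Cf * ((p ^ e : ℕ) : ℝ) ^ (lam₁ / 4)) * (p : ℝ) ^ (β * e) ≤
            C / p * (2 : ℝ) ^ (-(lam₁ / 8 * e)) := by
  set e₀ : ℕ := ⌈2 * (lam₂ + 1) / lam₁⌉₊ with he₀
  set D := (B + B ^ (lam₂ + 1)) * A ^ e₀ * Real.exp (c₁ * e₀) * (2 : ℝ) ^ (lam₁ / 8 * e₀) with hD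
  have hD0 : 0 < D := by positivity
  refine ⟨D + Cf, by positivity, fun h hh β hβ0 hβ p hp hβp e he => ?_⟩
  have hp0 : (0 : ℝ) < p := by exact_mod_cast hp.pos
  have hp1 : (1 : ℝ) ≤ p := by exact_mod_cast hp.pos
  have hp2 : (2 : ℝ) ≤ p := by exact_mod_cast hp.two_le
  have he0 : (0 : ℝ) ≤ e := by positivity
  have hh0 := hh.nonneg (p ^ e)
  have hx : 0 < (2 : ℝ) ^ (-(lam₁ / 8 * e)) := by positivity
  rcases le_or_gt e e₀ with hsmall | hlarge
  · have hh1 : h (p ^ e) ≤ (B + B ^ (lam₂ + 1)) / p := by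
      rcases lt_or_ge B p with hBlt | hBge
      · refine (hh.prime_pow_le p hp hBlt e he).trans ?_
        gcongr
        have : 0 < B ^ (lam₂ + 1) := by positivity
        linarith
      · rw [le_div_iff₀ hp0]
        calc h (p ^ e) * p ≤ (p : ℝ) ^ (-(e : ℝ) * lam₁ + lam₂) * p :=
              mul_le_mul_of_nonneg_right (hh.prime_pow_le_rpow p hp e he) hp0.le
          _ = (p : ℝ) ^ (-(e : ℝ) * lam₁ + lam₂ + 1) := by rw [Real.rpow_add_one hp0.ne']
          _ ≤ (p : ℝ) ^ (lam₂ + 1) := by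
              apply Real.rpow_le_rpow_of_exponent_le hp1
              nlinarith
          _ ≤ B ^ (lam₂ + 1) := Real.rpow_le_rpow hp0.le hBge (by linarith)
          _ ≤ _ := by linarith
    have hG : min (A ^ e) (Cf * ((p ^ e : ℕ) : ℝ) ^ (lam₁ / 4)) ≤ A ^ e₀ :=
      (min_le_left _ _).trans (pow_le_pow_right₀ hA hsmall)
    have hG0 : 0 ≤ min (A ^ e) (Cf * ((p ^ e : ℕ) : ℝ) ^ (lam₁ / 4)) :=
      le_min (by positivity) (by positivity)
    have hpow : (p : ℝ) ^ (β * e) ≤ Real.exp (c₁ * e₀) := by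
      rw [Real.rpow_def_of_pos hp0, Real.exp_le_exp]
      have h1 : (e : ℝ) ≤ e₀ := by exact_mod_cast hsmall
      calc Real.log p * (β * e) = (β * Real.log p) * e := by ring
        _ ≤ c₁ * e := mul_le_mul_of_nonneg_right hβp he0
        _ ≤ c₁ * e₀ := mul_le_mul_of_nonneg_left h1 hc₁
    have h2 : 1 ≤ (2 : ℝ) ^ (lam₁ / 8 * e₀) * (2 : ℝ) ^ (-(lam₁ / 8 * e)) := by
      rw [← Real.rpow_add two_pos]
      apply Real.one_le_rpow one_le_two
      have h1 : (e : ℝ) ≤ e₀ := by exact_mod_cast hsmall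
      nlinarith
    calc _ ≤ (B + B ^ (lam₂ + 1)) / p * A ^ e₀ * Real.exp (c₁ * e₀) := by gcongr
      _ ≤ (B + B ^ (lam₂ + 1)) / p * A ^ e₀ * Real.exp (c₁ * e₀) *
          ((2 : ℝ) ^ (lam₁ / 8 * e₀) * (2 : ℝ) ^ (-(lam₁ / 8 * e))) :=
          le_mul_of_one_le_right (by positivity) h2
      _ = D / p * (2 : ℝ) ^ (-(lam₁ / 8 * e)) := by rw [hD]; ring
      _ ≤ _ := by gcongr; linarith
  · have hlarge' : 2 * (lam₂ + 1) ≤ e * lam₁ := by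
      have h1 : 2 * (lam₂ + 1) / lam₁ ≤ e := by
        exact (Nat.le_ceil _).trans (by exact_mod_cast hlarge.le)
      rwa [div_le_iff₀ hlam₁] at h1
    have hG : min (A ^ e) (Cf * ((p ^ e : ℕ) : ℝ) ^ (lam₁ / 4)) ≤
        Cf * (p : ℝ) ^ (lam₁ / 4 * e) := by
      refine (min_le_right _ _).trans (le_of_eq ?_)
      push_cast
      rw [← Real.rpow_natCast, ← Real.rpow_mul hp0.le, mul_comm (e : ℝ)]
    calc _ ≤ (p : ℝ) ^ (-(e : ℝ) * lam₁ + lam₂) * (Cf * (p : ℝ) ^ (lam₁ / 4 * e)) *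
          (p : ℝ) ^ (β * e) := by
          gcongr
          exact hh.prime_pow_le_rpow p hp e he
      _ = Cf * (p : ℝ) ^ ((-(e : ℝ) * lam₁ + lam₂) + lam₁ / 4 * e + β * e) := by
          rw [Real.rpow_add hp0 _ (β * e), Real.rpow_add hp0 _ (lam₁ / 4 * e)]; ring
      _ ≤ Cf * (p : ℝ) ^ (-1 + -(lam₁ / 8 * e)) := by
          refine mul_le_mul_of_nonneg_left ?_ hCf.le
          apply Real.rpow_le_rpow_of_exponent_le hp1
          nlinarith
      _ = Cf / p * (p : ℝ) ^ (-(lam₁ / 8 * e)) := by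
          rw [Real.rpow_add hp0, Real.rpow_neg_one]; ring
      _ ≤ Cf / p * (2 : ℝ) ^ (-(lam₁ / 8 * e)) := by
          refine mul_le_mul_of_nonneg_left ?_ (by positivity)
          exact Real.rpow_le_rpow_of_nonpos two_pos hp2 (by have : 0 ≤ lam₁ / 8 * e := by positivity
                                                            linarith)
      _ ≤ _ := by gcongr; linarith

/-- The mechanism of Rankin's method: if `F (m * p ^ e) ≤ F m * w p e` for `p` not dividing `m`,
then inserting local factors `1 + φ p e` at the prime powers `p ^ e` exactly dividing `n`, for
`p ∈ S`, multiplies the sum of `F` by at most the corresponding Euler product. -/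
theorem sum_mul_prod_local_le (F : ℕ → ℝ) (w φ : ℕ → ℕ → ℝ) (hF : ∀ n, 0 ≤ F n)
    (hw : ∀ p e, 0 ≤ w p e) (hφ : ∀ p e, 0 ≤ φ p e) (hφ0 : ∀ p, φ p 0 = 0)
    (hFw : ∀ m p e : ℕ, 0 < m → p.Prime → ¬ p ∣ m → 1 ≤ e → F (m * p ^ e) ≤ F m * w p e)
    (N : ℕ) (E : ℕ → ℝ) (S : Finset ℕ) (hS : ∀ p ∈ S, p.Prime)
    (hE : ∀ p ∈ S, ∑ e ∈ Finset.Icc 1 N, w p e * φ p e ≤ E p) :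
    ∑ n ∈ Finset.Icc 1 N, F n * ∏ p ∈ S, (1 + φ p (n.factorization p)) ≤
      (∏ p ∈ S, (1 + E p)) * ∑ n ∈ Finset.Icc 1 N, F n := by
  induction S using Finset.induction_on with
  | empty => simp
  | insert q S hq ih =>
    have ih := ih (fun p hp => hS p (Finset.mem_insert_of_mem hp))
      fun p hp => hE p (Finset.mem_insert_of_mem hp)
    have hqp := hS q (Finset.mem_insert_self q S)
    set H : ℕ → ℝ := fun n => F n * ∏ p ∈ S, (1 + φ p (n.factorization p)) with hH
    have hH0 : ∀ n, 0 ≤ H n := fun n =>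
      mul_nonneg (hF n) (Finset.prod_nonneg fun p _ => by linarith [hφ p (n.factorization p)])
    have hHw : ∀ m e : ℕ, 0 < m → ¬ q ∣ m → 1 ≤ e → H (m * q ^ e) ≤ H m * w q e := by
      intro m e hm hqm he
      have hprod : ∏ p ∈ S, (1 + φ p ((m * q ^ e).factorization p)) =
          ∏ p ∈ S, (1 + φ p (m.factorization p)) := by
        refine Finset.prod_congr rfl fun p hp => ?_
        have hpq : q ≠ p := fun h => hq (h ▸ hp)
        rw [Nat.factorization_mul hm.ne' (pow_ne_zero e hqp.ne_zero), hqp.factorization_pow]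
        simp [hpq]
      simp only [hH, hprod]
      calc _ ≤ F m * w q e * ∏ p ∈ S, (1 + φ p (m.factorization p)) :=
            mul_le_mul_of_nonneg_right (hFw m q e hm hqp hqm he)
              (Finset.prod_nonneg fun p _ => by linarith [hφ p (m.factorization p)])
        _ = _ := by ring
    have hsplit : ∑ n ∈ Finset.Icc 1 N, F n * ∏ p ∈ insert q S, (1 + φ p (n.factorization p)) =
        ∑ n ∈ Finset.Icc 1 N, H n + ∑ n ∈ Finset.Icc 1 N, H n * φ q (n.factorization q) := by
      rw [← Finset.sum_add_distrib]
      refine Finset.sum_congr rfl fun n _ => ?_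
      rw [Finset.prod_insert hq]
      simp only [hH]; ring
    have hpart : ∑ n ∈ Finset.Icc 1 N, H n * φ q (n.factorization q) ≤
        ∑ x ∈ Finset.Icc 1 N ×ˢ Finset.Icc 1 N, H x.1 * (w q x.2 * φ q x.2) := by
      rw [← Finset.sum_filter_add_sum_filter_not _ (fun n => q ∣ n)]
      have hz : ∑ n ∈ (Finset.Icc 1 N).filter (fun n => ¬ q ∣ n),
          H n * φ q (n.factorization q) = 0 :=
        Finset.sum_eq_zero fun n hn => by
          rw [Nat.factorization_eq_zero_of_not_dvd (Finset.mem_filter.1 hn).2, hφ0, mul_zero]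
      rw [hz, add_zero]
      have hinj : Set.InjOn (fun n : ℕ => (n / q ^ n.factorization q, n.factorization q))
          ((Finset.Icc 1 N).filter (fun n => q ∣ n) : Finset ℕ) := by
        intro n _ n' _ h
        simp only [Prod.mk.injEq] at h
        rw [← Nat.ordProj_mul_ordCompl_eq_self n q, ← Nat.ordProj_mul_ordCompl_eq_self n' q,
          h.1, h.2]
      calc _ ≤ ∑ n ∈ (Finset.Icc 1 N).filter (fun n => q ∣ n),
            H (n / q ^ n.factorization q) *
              (w q (n.factorization q) * φ q (n.factorization q)) := by
            refine Finset.sum_le_sum fun n hn => ?_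
            obtain ⟨hnI, hqn⟩ := Finset.mem_filter.1 hn
            have hn0 : n ≠ 0 := by have := (Finset.mem_Icc.1 hnI).1; omega
            have h1 := hHw (n / q ^ n.factorization q) (n.factorization q)
              (Nat.ordCompl_pos q hn0) (Nat.not_dvd_ordCompl hqp hn0)
              ((hqp.dvd_iff_one_le_factorization hn0).1 hqn)
            rw [mul_comm (n / q ^ n.factorization q), Nat.ordProj_mul_ordCompl_eq_self] at h1
            have := mul_le_mul_of_nonneg_right h1 (hφ q (n.factorization q))
            linarith
        _ = ∑ x ∈ ((Finset.Icc 1 N).filter (fun n => q ∣ n)).image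
              (fun n : ℕ => (n / q ^ n.factorization q, n.factorization q)),
              H x.1 * (w q x.2 * φ q x.2) := by rw [Finset.sum_image hinj]
        _ ≤ _ := by
            refine Finset.sum_le_sum_of_subset_of_nonneg ?_ fun x _ _ =>
              mul_nonneg (hH0 _) (mul_nonneg (hw _ _) (hφ _ _))
            intro x hx
            obtain ⟨n, hn, rfl⟩ := Finset.mem_image.1 hx
            obtain ⟨hnI, hqn⟩ := Finset.mem_filter.1 hn
            obtain ⟨hn1, hnN⟩ := Finset.mem_Icc.1 hnI
            have hn0 : n ≠ 0 := by omega
            simp only [Finset.mem_product, Finset.mem_Icc]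
            exact ⟨⟨Nat.ordCompl_pos q hn0, (Nat.div_le_self _ _).trans hnN⟩,
              (hqp.dvd_iff_one_le_factorization hn0).1 hqn,
              (Nat.factorization_lt q hn0).le.trans hnN⟩
    rw [Finset.sum_product] at hpart
    simp only [← Finset.mul_sum, ← Finset.sum_mul] at hpart
    have hsumH : 0 ≤ ∑ n ∈ Finset.Icc 1 N, H n := Finset.sum_nonneg fun n _ => hH0 n
    have hEq := hE q (Finset.mem_insert_self q S)
    have hEq0 : 0 ≤ E q := le_trans
      (Finset.sum_nonneg fun e _ => mul_nonneg (hw q e) (hφ q e)) hEq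
    rw [hsplit, Finset.prod_insert hq]
    calc _ ≤ (∑ n ∈ Finset.Icc 1 N, H n) + (∑ n ∈ Finset.Icc 1 N, H n) * E q := by
          have := mul_le_mul_of_nonneg_left hEq hsumH
          linarith
      _ = (1 + E q) * ∑ n ∈ Finset.Icc 1 N, H n := by ring
      _ ≤ (1 + E q) * ((∏ p ∈ S, (1 + E p)) * ∑ n ∈ Finset.Icc 1 N, F n) :=
          mul_le_mul_of_nonneg_left ih (by linarith)
      _ = _ := by ring

theorem exists_sum_nat_mul_two_rpow_neg_le {δ : ℝ} (hδ : 0 < δ) :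
    ∃ C : ℝ, 0 < C ∧ ∀ N : ℕ, ∑ e ∈ Finset.Icc 1 N, (e : ℝ) * (2 : ℝ) ^ (-(δ * e)) ≤ C := by
  set r : ℝ := (2 : ℝ) ^ (-δ) with hr
  have hr0 : 0 < r := by positivity
  have hr1 : r < 1 := Real.rpow_lt_one_of_one_lt_of_neg one_lt_two (by linarith)
  have hsum : Summable fun e : ℕ => (e : ℝ) * r ^ e := by
    simpa using summable_pow_mul_geometric_of_norm_lt_one (R := ℝ) 1
      (r := r) (by rwa [Real.norm_of_nonneg hr0.le])
  have hnn : ∀ e : ℕ, 0 ≤ (e : ℝ) * r ^ e := fun e => by positivity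
  refine ⟨∑' e : ℕ, (e : ℝ) * r ^ e + 1,
    add_pos_of_nonneg_of_pos (tsum_nonneg hnn) one_pos, fun N => ?_⟩
  have h1 := hsum.sum_le_tsum (Finset.Icc 1 N) fun e _ => hnn e
  have h2 : ∑ e ∈ Finset.Icc 1 N, (e : ℝ) * (2 : ℝ) ^ (-(δ * e)) =
      ∑ e ∈ Finset.Icc 1 N, (e : ℝ) * r ^ e := by
    refine Finset.sum_congr rfl fun e _ => ?_
    rw [hr, ← Real.rpow_natCast ((2 : ℝ) ^ (-δ)), ← Real.rpow_mul two_pos.le, neg_mul]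
  linarith

/-- Rankin's method: over the integers composed of primes in `S`, inserting the weight `n ^ β` and
the factors `(1 - h p)⁻¹` at the primes dividing `n` enlarges `∑ f n * h n` by a constant only,
provided `β * log p` is bounded on `S`, individually and on average. -/
theorem exists_rankin_bound (κ : ℝ) {lam₁ lam₂ B A c₁ : ℝ} (K : ℝ) (hB : 0 < B)
    (hlam₁ : 0 < lam₁) (hlam₂ : 0 < lam₂) (hA : 1 ≤ A) (hc₁ : 0 ≤ c₁) {f : ArithmeticFunction ℝ}
    (hf : ∀ ε : ℝ, 0 < ε → ∃ C : ℝ, 0 < C ∧ IsSubmultClass A ε C f) :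
    ∃ C : ℝ, 0 < C ∧ ∀ h : ArithmeticFunction ℝ, IsDensityFunction κ lam₁ lam₂ B K h →
      ∀ β : ℝ, 0 ≤ β → β ≤ lam₁ / 8 → ∀ S : Finset ℕ,
        (∀ p ∈ S, p.Prime ∧ β * Real.log p ≤ c₁) → β * ∑ p ∈ S, Real.log p / p ≤ c₁ → ∀ N : ℕ,
          ∑ n ∈ (Finset.Icc 1 N).filter (fun n => n.primeFactors ⊆ S), f n * h n *
            ((n : ℝ) ^ β * ∏ p ∈ n.primeFactors.filter (fun p : ℕ => B < p), (1 - h p)⁻¹) ≤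
          C * ∑ n ∈ Finset.Icc 1 N, f n * h n := by
  obtain ⟨Cf, hCf, hfC⟩ := hf (lam₁ / 4) (by positivity)
  obtain ⟨D, hD, hDp⟩ := exists_exp_neg_div_le_one_sub hB
  obtain ⟨W, hW, hWw⟩ := exists_rankin_weight_le κ K hB hlam₁ hlam₂ hA hCf hc₁
  obtain ⟨G, hG, hGs⟩ := exists_sum_nat_mul_two_rpow_neg_le (δ := lam₁ / 8) (by positivity)
  set D' : ℝ := D * Real.exp D with hD'
  have hD'0 : 0 < D' := by positivity
  refine ⟨Real.exp (W * G * (c₁ + D' * 2)), Real.exp_pos _, fun h hh β hβ0 hβ S hS hβS N => ?_⟩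
  set v : ℕ → ℝ := fun p => if B < p then (1 - h p)⁻¹ else 1 with hv
  have hv1 : ∀ p : ℕ, p.Prime → 1 ≤ v p ∧ v p ≤ 1 + D' / p := fun p hp => by
    have hp1 : (1 : ℝ) ≤ p := by exact_mod_cast hp.pos
    simp only [hv]
    split_ifs with hBp
    · have h1 := hh.apply_prime_lt_one hB hp hBp
      have h2 := hDp p _ hBp (hh.apply_prime_le hp hBp)
      refine ⟨(one_le_inv₀ (by linarith)).2 (by linarith [hh.nonneg p]), ?_⟩
      have h3 : (1 - h p)⁻¹ ≤ Real.exp (D / p) := by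
        rw [inv_le_comm₀ (by linarith) (Real.exp_pos _), ← Real.exp_neg]; exact h2
      have h4 : Real.exp (D / p) ≤ 1 + D / p * Real.exp (D / p) := by
        have h5 := Real.add_one_le_exp (-(D / p))
        have h6 := mul_le_mul_of_nonneg_right h5 (Real.exp_pos (D / p)).le
        rw [← Real.exp_add, neg_add_cancel, Real.exp_zero] at h6
        linarith
      have h7 : Real.exp (D / p) ≤ Real.exp D := Real.exp_le_exp.2 (div_le_self hD.le hp1)
      have h8 : D / p * Real.exp (D / p) ≤ D / p * Real.exp D :=
        mul_le_mul_of_nonneg_left h7 (by positivity)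
      have h9 : D / p * Real.exp D = D' / p := by rw [hD']; ring
      linarith
    · exact ⟨le_rfl, by have : 0 ≤ D' / p := by positivity
                        linarith⟩
  set φ : ℕ → ℕ → ℝ := fun p e => if e = 0 ∨ ¬ p.Prime then 0 else (p : ℝ) ^ (β * e) * v p - 1
    with hφdef
  have hφ : ∀ p e, 0 ≤ φ p e := fun p e => by
    simp only [hφdef]
    split_ifs with hc
    · exact le_rfl
    · push Not at hc
      have h1 := (hv1 p hc.2).1
      have h2 : 1 ≤ (p : ℝ) ^ (β * e) :=
        Real.one_le_rpow (by exact_mod_cast hc.2.pos) (by positivity)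
      nlinarith
  set w : ℕ → ℕ → ℝ := fun p e => h (p ^ e) * min (A ^ e) (Cf * ((p ^ e : ℕ) : ℝ) ^ (lam₁ / 4))
    with hwdef
  have hw : ∀ p e, 0 ≤ w p e := fun p e =>
    mul_nonneg (hh.nonneg _) (le_min (by positivity) (by positivity))
  have hφle : ∀ p : ℕ, p.Prime → ∀ e : ℕ, 1 ≤ e →
      φ p e ≤ (p : ℝ) ^ (β * e) * (e * (β * Real.log p + D' / p)) := fun p hp e he => by
    have hp0 : (0 : ℝ) < p := by exact_mod_cast hp.pos
    have he1 : (1 : ℝ) ≤ e := by exact_mod_cast he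
    simp only [hφdef]
    rw [if_neg (by push Not; exact ⟨by omega, hp⟩)]
    set z := (p : ℝ) ^ (β * e) with hz
    have hz0 : 0 < z := by positivity
    have h1 : z - 1 ≤ z * (e * (β * Real.log p)) := by
      have h5 := Real.add_one_le_exp (-(Real.log p * (β * e)))
      have h6 := mul_le_mul_of_nonneg_left h5 hz0.le
      rw [hz, Real.rpow_def_of_pos hp0, ← Real.exp_add, add_neg_cancel, Real.exp_zero] at h6
      rw [hz, Real.rpow_def_of_pos hp0]
      linarith
    have h2 := mul_le_mul_of_nonneg_left (hv1 p hp).2 hz0.le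
    have h3 : z * (D' / p) ≤ z * (e * (D' / p)) :=
      mul_le_mul_of_nonneg_left (le_mul_of_one_le_left (by positivity) he1) hz0.le
    nlinarith
  set E : ℕ → ℝ := fun p => W * G * (β * (Real.log p / p) + D' * (1 / (p : ℝ) ^ 2)) with hEdef
  have hE : ∀ p ∈ S, ∑ e ∈ Finset.Icc 1 N, w p e * φ p e ≤ E p := fun p hp => by
    obtain ⟨hpp, hpc⟩ := hS p hp
    have hp0 : (0 : ℝ) < p := by exact_mod_cast hpp.pos
    have hlp : 0 ≤ Real.log p := Real.log_natCast_nonneg p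
    calc ∑ e ∈ Finset.Icc 1 N, w p e * φ p e
        ≤ ∑ e ∈ Finset.Icc 1 N,
          (W / p * (β * Real.log p + D' / p)) * ((e : ℝ) * (2 : ℝ) ^ (-(lam₁ / 8 * e))) := by
          refine Finset.sum_le_sum fun e he => ?_
          have he1 := (Finset.mem_Icc.1 he).1
          have h1 := mul_le_mul_of_nonneg_left (hφle p hpp e he1) (hw p e)
          have h2 := mul_le_mul_of_nonneg_right (hWw h hh β hβ0 hβ p hpp hpc e he1)
            (show 0 ≤ (e : ℝ) * (β * Real.log p + D' / p) by positivity)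
          simp only [hwdef] at h1 ⊢
          linarith
      _ ≤ (W / p * (β * Real.log p + D' / p)) * G := by
          rw [← Finset.mul_sum]
          exact mul_le_mul_of_nonneg_left (hGs N) (by positivity)
      _ = E p := by simp only [hEdef]; field_simp
  have hmain := sum_mul_prod_local_le (fun n => f n * h n) w φ
    (fun n => mul_nonneg (hfC.nonneg n) (hh.nonneg n)) hw hφ (fun p => by simp [hφdef])
    (fun m p e hm hp hpm he => by
      have hcop : m.Coprime (p ^ e) := ((hp.coprime_iff_not_dvd.2 hpm).symm).pow_right e
      have h1 := hfC.mul_le m (p ^ e) hm (pow_pos hp.pos e) hcop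
      rw [ArithmeticFunction.cardFactors_apply_prime_pow hp] at h1
      simp only [hwdef]
      rw [hh.isMultiplicative.map_mul_of_coprime hcop]
      have h2 := mul_le_mul_of_nonneg_right h1 (mul_nonneg (hh.nonneg m) (hh.nonneg (p ^ e)))
      linarith) N E S (fun p hp => (hS p hp).1) hE
  have hFsum : 0 ≤ ∑ n ∈ Finset.Icc 1 N, f n * h n :=
    Finset.sum_nonneg fun n _ => mul_nonneg (hfC.nonneg n) (hh.nonneg n)
  have hprodE : ∏ p ∈ S, (1 + E p) ≤ Real.exp (W * G * (c₁ + D' * 2)) := by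
    calc ∏ p ∈ S, (1 + E p) ≤ ∏ p ∈ S, Real.exp (E p) := by
          refine Finset.prod_le_prod (fun p _ => ?_) fun p _ => ?_
          · have : 0 ≤ E p := by
              have hlp : 0 ≤ Real.log p := Real.log_natCast_nonneg p
              simp only [hEdef]; positivity
            linarith
          · rw [add_comm]; exact Real.add_one_le_exp _
      _ = Real.exp (∑ p ∈ S, E p) := (Real.exp_sum _ _).symm
      _ ≤ _ := by
          apply Real.exp_le_exp.2
          simp only [hEdef]
          rw [← Finset.mul_sum, Finset.sum_add_distrib, ← Finset.mul_sum, ← Finset.mul_sum]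
          refine mul_le_mul_of_nonneg_left (add_le_add hβS ?_) (by positivity)
          exact mul_le_mul_of_nonneg_left (sum_inv_sq_prime_le fun p hp => (hS p hp).1) hD'0.le
  refine le_trans ?_ (hmain.trans (mul_le_mul_of_nonneg_right hprodE hFsum))
  have hterm : ∀ n ∈ (Finset.Icc 1 N).filter (fun n => n.primeFactors ⊆ S),
      (n : ℝ) ^ β * ∏ p ∈ n.primeFactors.filter (fun p : ℕ => B < p), (1 - h p)⁻¹ =
        ∏ p ∈ S, (1 + φ p (n.factorization p)) := by
    intro n hn
    obtain ⟨hnI, hnS⟩ := Finset.mem_filter.1 hn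
    have hn0 : n ≠ 0 := by have := (Finset.mem_Icc.1 hnI).1; omega
    have e1 : ∏ p ∈ n.primeFactors, (1 + φ p (n.factorization p)) =
        ∏ p ∈ S, (1 + φ p (n.factorization p)) := by
      refine Finset.prod_subset hnS fun p _ hpn => ?_
      have : n.factorization p = 0 := by
        rwa [← Finsupp.notMem_support_iff, Nat.support_factorization]
      simp [hφdef, this]
    have e2 : ∏ p ∈ n.primeFactors, (1 + φ p (n.factorization p)) =
        ∏ p ∈ n.primeFactors, ((p : ℝ) ^ (β * n.factorization p) * v p) := by
      refine Finset.prod_congr rfl fun p hp => ?_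
      have hpp := Nat.prime_of_mem_primeFactors hp
      have : n.factorization p ≠ 0 := by
        rwa [← Finsupp.mem_support_iff, Nat.support_factorization]
      simp only [hφdef]
      rw [if_neg (by push Not; exact ⟨this, hpp⟩)]
      ring
    have e3 : (n : ℝ) ^ β = ∏ p ∈ n.primeFactors, (p : ℝ) ^ (β * n.factorization p) := by
      have : (n : ℝ) = ∏ p ∈ n.primeFactors, (p : ℝ) ^ n.factorization p := by
        conv_lhs => rw [← Nat.prod_factorization_pow_eq_self hn0]
        rw [Finsupp.prod, Nat.support_factorization]
        push_cast
        rfl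
      conv_lhs => rw [this]
      rw [← Real.finsetProd_rpow _ _ fun p _ => by positivity]
      refine Finset.prod_congr rfl fun p _ => ?_
      rw [← Real.rpow_natCast, ← Real.rpow_mul (by positivity), mul_comm]
    rw [← e1, e2, Finset.prod_mul_distrib, ← e3, Finset.prod_filter]
  rw [Finset.sum_congr rfl fun n hn => by rw [hterm n hn]]
  refine Finset.sum_le_sum_of_subset_of_nonneg (Finset.filter_subset _ _) fun n _ _ => ?_
  exact mul_nonneg (mul_nonneg (hfC.nonneg n) (hh.nonneg n))
    (Finset.prod_nonneg fun p _ => by linarith [hφ p (n.factorization p)])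

/-! ### Cutting an integer into a smooth and a rough part -/

/-- The part of `c` composed of the primes below `n`. -/
def primePartBelow (n c : ℕ) : ℕ :=
  ∏ p ∈ c.primeFactors.filter (fun p => p < n), p ^ c.factorization p

theorem primePartBelow_zero (c : ℕ) : primePartBelow 0 c = 1 := by simp [primePartBelow]

theorem primePartBelow_pos (n c : ℕ) : 0 < primePartBelow n c :=
  Finset.prod_pos fun _ hp =>
    pow_pos (Nat.prime_of_mem_primeFactors (Finset.mem_filter.1 hp).1).pos _

theorem lt_of_prime_dvd_primePartBelow {n c p : ℕ} (hp : p.Prime) (h : p ∣ primePartBelow n c) :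
    p < n := by
  obtain ⟨q, hq, hpq⟩ := (hp.prime.dvd_finsetProd_iff _).1 h
  obtain ⟨hq1, hq2⟩ := Finset.mem_filter.1 hq
  rwa [(Nat.prime_dvd_prime_iff_eq hp (Nat.prime_of_mem_primeFactors hq1)).1
    (hp.dvd_of_dvd_pow hpq)]

theorem primePartBelow_succ {n c : ℕ} :
    primePartBelow (n + 1) c =
      primePartBelow n c * (if n ∈ c.primeFactors then n ^ c.factorization n else 1) := by
  simp only [primePartBelow, Finset.prod_filter]
  rw [← Finset.prod_ite_eq' c.primeFactors n (fun p => p ^ c.factorization p),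
    ← Finset.prod_mul_distrib]
  refine Finset.prod_congr rfl fun p _ => ?_
  rcases lt_trichotomy p n with h | h | h
  · simp [h, h.ne, Nat.lt_succ_of_lt h]
  · simp [h]
  · simp [h.ne', not_lt.2 h.le, show ¬ p < n + 1 by omega]

theorem exists_eq_primePartBelow_mul (n : ℕ) {c : ℕ} (hc : 0 < c) :
    ∃ d, c = primePartBelow n c * d ∧ (primePartBelow n c).Coprime d ∧
      ∀ p, p.Prime → p ∣ d → n ≤ p := by
  have hle : ∀ p, p.Prime → p ∣ ∏ p ∈ c.primeFactors.filter (fun p => ¬ p < n),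
      p ^ c.factorization p →
      n ≤ p := by
    intro p hp h
    obtain ⟨q, hq, hpq⟩ := (hp.prime.dvd_finsetProd_iff _).1 h
    obtain ⟨hq1, hq2⟩ := Finset.mem_filter.1 hq
    rw [(Nat.prime_dvd_prime_iff_eq hp (Nat.prime_of_mem_primeFactors hq1)).1
      (hp.dvd_of_dvd_pow hpq)]
    exact not_lt.1 hq2
  refine ⟨∏ p ∈ c.primeFactors.filter (fun p => ¬ p < n), p ^ c.factorization p, ?_, ?_, hle⟩
  · rw [primePartBelow, Finset.prod_filter_mul_prod_filter_not]
    conv_lhs => rw [← Nat.prod_factorization_pow_eq_self hc.ne']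
    rw [Finsupp.prod, Nat.support_factorization]
  · refine Nat.Coprime.symm (Nat.coprime_of_dvd fun p hp h1 h2 => ?_)
    exact absurd (lt_of_prime_dvd_primePartBelow hp h2) (not_lt.2 (hle p hp h1))

/-- Cutting `c` just before its prime-by-prime partial products exceed `X`. -/
theorem primePartBelow_le_or_exists_prime (c z : ℕ) {X : ℝ} (hX : 1 ≤ X) :
    (primePartBelow (z + 1) c : ℝ) ≤ X ∨ ∃ q, q.Prime ∧ q ≤ z ∧ q ∣ c ∧
      (primePartBelow q c : ℝ) ≤ X ∧
      X < (primePartBelow q c : ℝ) * ((q ^ c.factorization q : ℕ) : ℝ) := by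
  classical
  by_cases hz : (primePartBelow (z + 1) c : ℝ) ≤ X
  · exact Or.inl hz
  right
  have hex : ∃ n, X < (primePartBelow (n + 1) c : ℝ) := ⟨z, not_le.1 hz⟩
  set q := Nat.find hex with hq
  have hq1 : X < (primePartBelow (q + 1) c : ℝ) := Nat.find_spec hex
  have hqz : q ≤ z := Nat.find_min' hex (not_le.1 hz)
  have hq2 : (primePartBelow q c : ℝ) ≤ X := by
    rcases Nat.eq_zero_or_pos q with h0 | h0
    · rw [h0, primePartBelow_zero]; simpa using hX
    · have := Nat.find_min hex (m := q - 1) (by omega)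
      rw [Nat.sub_add_cancel h0] at this
      exact not_lt.1 this
  rw [primePartBelow_succ] at hq1
  by_cases hmem : q ∈ c.primeFactors
  · rw [if_pos hmem] at hq1
    exact ⟨q, Nat.prime_of_mem_primeFactors hmem, hqz, Nat.dvd_of_mem_primeFactors hmem, hq2,
      by exact_mod_cast hq1⟩
  · rw [if_neg hmem, mul_one] at hq1
    exact absurd hq2 (not_le.2 hq1)

theorem exists_lt_prime_pow_of_smooth {b n : ℕ} {R : ℝ} (hb : 0 < b) (hR : 1 ≤ R)
    (hbn : ∀ p, p.Prime → p ∣ b → p < n) (hbR : R ^ n < b) :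
    ∃ p, p.Prime ∧ p < n ∧ R < ((p ^ b.factorization p : ℕ) : ℝ) := by
  by_contra hcon
  push Not at hcon
  have hcard : b.primeFactors.card ≤ n := by
    have : b.primeFactors ⊆ Finset.range n := fun p hp => Finset.mem_range.2
      (hbn p (Nat.prime_of_mem_primeFactors hp) (Nat.dvd_of_mem_primeFactors hp))
    exact (Finset.card_le_card this).trans (Finset.card_range n).le
  have : (b : ℝ) ≤ R ^ n := by
    calc (b : ℝ) = ∏ p ∈ b.primeFactors, ((p ^ b.factorization p : ℕ) : ℝ) := by
          conv_lhs => rw [← Nat.prod_factorization_pow_eq_self hb.ne']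
          rw [Finsupp.prod, Nat.support_factorization, Nat.cast_prod]
      _ ≤ R ^ b.primeFactors.card := by
          rw [← Finset.prod_const]
          refine Finset.prod_le_prod (fun p _ => by positivity) fun p hp => ?_
          exact hcon p (Nat.prime_of_mem_primeFactors hp)
            (hbn p (Nat.prime_of_mem_primeFactors hp) (Nat.dvd_of_mem_primeFactors hp))
      _ ≤ R ^ n := pow_le_pow_right₀ hR hcard
  linarith

theorem pow_cardFactors_le {Y : ℝ} (hY : 0 ≤ Y) {d : ℕ} (hd : 0 < d)
    (h : ∀ p, p.Prime → p ∣ d → Y ≤ p) : Y ^ Ω d ≤ d := by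
  induction d using Nat.recOnMul with
  | zero => omega
  | one => simp
  | prime p hp => simpa [ArithmeticFunction.cardFactors_apply_prime hp] using h p hp dvd_rfl
  | mul a b iha ihb =>
    have ha : 0 < a := Nat.pos_of_mul_pos_right hd
    have hb : 0 < b := Nat.pos_of_mul_pos_left hd
    rw [ArithmeticFunction.cardFactors_mul ha.ne' hb.ne', pow_add, Nat.cast_mul]
    exact mul_le_mul (iha ha fun p hp hpa => h p hp (hpa.mul_right b))
      (ihb hb fun p hp hpb => h p hp (hpb.mul_left a)) (by positivity) (by positivity)

/-- Replacing the primes up to `Y` not dividing `b` by all the primes up to `M` in a sieve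
product. -/
theorem prod_one_sub_le_sieveProduct_mul {κ lam₁ lam₂ B K D M Y : ℝ} {h : ArithmeticFunction ℝ}
    (hB : 0 < B) (hD : 0 < D)
    (hDp : ∀ (p : ℕ) (u : ℝ), B < p → u ≤ B / p → Real.exp (-(D / p)) ≤ 1 - u)
    (hh : IsDensityFunction κ lam₁ lam₂ B K h) (hY : 1 < Y) (hM : 1 ≤ M) {b : ℕ} (hb : b ≠ 0) :
    ∏ p ∈ (Finset.Icc 1 ⌊Y⌋₊).filter (fun p : ℕ => p.Prime ∧ B < (p : ℝ) ∧ ¬ p ∣ b), (1 - h p) ≤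
      sieveProduct B M h *
        (∏ p ∈ b.primeFactors.filter (fun p : ℕ => B < p), (1 - h p)⁻¹) *
        Real.exp (D * ((Real.log M + Real.log 4) / Real.log Y)) := by
  set Q := (Finset.Icc 1 ⌊Y⌋₊).filter (fun p : ℕ => p.Prime ∧ B < (p : ℝ) ∧ ¬ p ∣ b) with hQ
  set P := b.primeFactors.filter (fun p : ℕ => B < p) with hP
  set T := ((Finset.Icc 1 ⌊M⌋₊).filter (fun p : ℕ => p.Prime ∧ B < (p : ℝ))).filter
    (fun p : ℕ => Y < p) with hT
  have hQ' : ∀ p ∈ Q, p.Prime ∧ B < (p : ℝ) := fun p hp => by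
    simp only [hQ, Finset.mem_filter] at hp; exact ⟨hp.2.1, hp.2.2.1⟩
  have hP' : ∀ p ∈ P, p.Prime ∧ B < (p : ℝ) := fun p hp => by
    simp only [hP, Finset.mem_filter] at hp; exact ⟨Nat.prime_of_mem_primeFactors hp.1, hp.2⟩
  have hT' : ∀ p ∈ T, p.Prime ∧ B < (p : ℝ) := fun p hp => by
    simp only [hT, Finset.mem_filter] at hp; exact hp.1.2
  have hQ0 := hh.prod_one_sub_pos hB hQ'
  have hP0 := hh.prod_one_sub_pos hB hP'
  have hT0 : Real.exp (-(D * ((Real.log M + Real.log 4) / Real.log Y))) ≤ ∏ p ∈ T, (1 - h p) := by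
    refine le_trans ?_ (exp_neg_le_prod_one_sub (D := D) fun p hp =>
      hDp p _ (hT' p hp).2 (hh.apply_prime_le (hT' p hp).1 (hT' p hp).2))
    apply Real.exp_le_exp.2
    rw [neg_le_neg_iff]
    refine mul_le_mul_of_nonneg_left (sum_inv_prime_le hM hY fun p hp => ?_) hD.le
    refine ⟨(hT' p hp).1, ?_, ?_⟩
    · simp only [hT, Finset.mem_filter, Finset.mem_Icc] at hp
      exact (Nat.le_floor_iff (by linarith)).1 hp.1.1.2
    · simp only [hT, Finset.mem_filter] at hp
      exact hp.2.le
  have hcover : (∏ p ∈ Q, (1 - h p)) * ((∏ p ∈ P, (1 - h p)) * ∏ p ∈ T, (1 - h p)) ≤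
      sieveProduct B M h := by
    have hall : ∀ p ∈ Q ∪ (P ∪ T), p.Prime ∧ B < (p : ℝ) := fun p hp => by
      rcases Finset.mem_union.1 hp with hp | hp
      · exact hQ' p hp
      rcases Finset.mem_union.1 hp with hp | hp
      · exact hP' p hp
      · exact hT' p hp
    have hsub : (Finset.Icc 1 ⌊M⌋₊).filter (fun p : ℕ => p.Prime ∧ B < (p : ℝ)) ⊆
        Q ∪ (P ∪ T) := by
      intro p hp
      obtain ⟨hpI, hpp, hpB⟩ := Finset.mem_filter.1 hp
      simp only [Finset.mem_union]
      by_cases hpY : Y < p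
      · exact Or.inr (Or.inr (Finset.mem_filter.2 ⟨hp, hpY⟩))
      by_cases hpb : p ∣ b
      · exact Or.inr (Or.inl (Finset.mem_filter.2 ⟨Nat.mem_primeFactors.2 ⟨hpp, hpb, hb⟩, hpB⟩))
      · exact Or.inl (Finset.mem_filter.2 ⟨Finset.mem_Icc.2 ⟨hpp.pos, Nat.le_floor (not_lt.1 hpY)⟩,
          hpp, hpB, hpb⟩)
    have hdecr : ∀ U V : Finset ℕ, (∀ p ∈ U ∪ V, p.Prime ∧ B < (p : ℝ)) →
        (∏ p ∈ U, (1 - h p)) * ∏ p ∈ V, (1 - h p) ≤ ∏ p ∈ U ∪ V, (1 - h p) := by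
      intro U V hUV
      rw [← Finset.prod_union_inter]
      refine mul_le_of_le_one_right (hh.prod_one_sub_pos hB hUV).le ?_
      refine Finset.prod_le_one (fun p hp => ?_) fun p _ => by linarith [hh.nonneg p]
      have := hUV p (Finset.mem_union_left _ (Finset.mem_inter.1 hp).1)
      linarith [hh.apply_prime_lt_one hB this.1 this.2]
    calc _ ≤ (∏ p ∈ Q, (1 - h p)) * ∏ p ∈ P ∪ T, (1 - h p) :=
          mul_le_mul_of_nonneg_left (hdecr P T fun p hp => hall p (Finset.mem_union_right _ hp))
            hQ0.le
      _ ≤ ∏ p ∈ Q ∪ (P ∪ T), (1 - h p) := hdecr _ _ hall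
      _ ≤ _ := hh.prod_one_sub_le_of_subset hB hsub hall
  rw [Finset.prod_inv_distrib]
  set q := ∏ p ∈ Q, (1 - h p)
  set r := ∏ p ∈ P, (1 - h p)
  set t := ∏ p ∈ T, (1 - h p)
  set u := D * ((Real.log M + Real.log 4) / Real.log Y)
  have h1 : 1 ≤ t * Real.exp u := by
    calc (1 : ℝ) = Real.exp (-u) * Real.exp u := by rw [← Real.exp_add]; simp
      _ ≤ _ := mul_le_mul_of_nonneg_right hT0 (Real.exp_pos _).le
  calc q ≤ q * (t * Real.exp u) := le_mul_of_one_le_right hQ0.le h1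
    _ = (q * (r * t)) * r⁻¹ * Real.exp u := by field_simp
    _ ≤ _ := by gcongr

/-! ### Contributions of size a power of `M` smaller than the main term -/

/-- The total weight of the elements divisible by a prime power `p ^ v > R` with `p ≤ y` small. -/
theorem exists_sum_prime_pow_dvd_le {θ ξ κ lam₁ lam₂ B K L₁ L₂ : ℝ} (hB : 0 < B)
    (hlam₁ : 0 < lam₁) (hlam₂ : 0 < lam₂) (hL₁ : 0 < L₁) (hL₂ : 0 < L₂) :
    ∃ δ : ℝ, 0 < δ ∧ δ ≤ 1 ∧ ∃ C : ℝ, 0 < C ∧ ∀ {𝒜 : Type*} (S : Finset 𝒜) (χ : 𝒜 → ℝ) (c : 𝒜 → ℕ)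
      (M : ℝ) (h : ArithmeticFunction ℝ), IsDensityFunction κ lam₁ lam₂ B K h →
      IsEquidistributedAt θ ξ B L₁ L₂ S χ c M h →
      ∀ (y : ℕ) (R : ℝ), 1 ≤ R → (y : ℝ) * R ≤ M ^ θ → ∀ S' ⊆ S,
      (∀ a ∈ S', ∃ p v : ℕ, p.Prime ∧ p ≤ y ∧ p ^ v ∣ c a ∧ R < ((p ^ v : ℕ) : ℝ)) →
      ∑ a ∈ S', χ a ≤ y * (C * R ^ (-δ) * M + L₂ * M ^ (1 - ξ)) := by
  obtain ⟨δ, hδ0, hδ1, C, hC, hpow⟩ := exists_apply_prime_pow_le κ K hB hlam₁ hlam₂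
  refine ⟨δ, hδ0, hδ1, C * (1 + L₁), by positivity, ?_⟩
  intro 𝒜 S χ c M h hh hE y R hR hyR S' hS' hbad
  have hM0 : 0 < M := by linarith [hE.one_le]
  have hex : ∀ p : ℕ, p.Prime → ∃ g : ℕ, R < (p : ℝ) ^ g := fun p hp =>
    pow_unbounded_of_one_lt R (by exact_mod_cast hp.one_lt)
  classical
  set g : ℕ → ℕ := fun p => if hp : p.Prime then Nat.find (hex p hp) else 0 with hg
  have hgR : ∀ p : ℕ, p.Prime → R < (p : ℝ) ^ g p := fun p hp => by
    simp only [hg, dif_pos hp]; exact Nat.find_spec (hex p hp)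
  have hgmin : ∀ p : ℕ, p.Prime → ∀ v : ℕ, R < (p : ℝ) ^ v → g p ≤ v := fun p hp v hv => by
    simp only [hg, dif_pos hp]; exact Nat.find_min' (hex p hp) hv
  have hg1 : ∀ p : ℕ, p.Prime → 1 ≤ g p := fun p hp => by
    by_contra h0
    have := hgR p hp
    rw [show g p = 0 by omega, pow_zero] at this
    linarith
  have hgle : ∀ p : ℕ, p.Prime → (p : ℝ) ^ g p ≤ p * R := fun p hp => by
    have h1 : (p : ℝ) ^ (g p - 1) ≤ R := by
      by_contra hcon
      have := hgmin p hp (g p - 1) (not_le.1 hcon)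
      have := hg1 p hp
      omega
    rw [← Nat.sub_add_cancel (hg1 p hp), pow_succ, mul_comm]
    exact mul_le_mul_of_nonneg_left h1 (by positivity)
  have hP : ∀ p ∈ (Finset.Icc 1 y).filter Nat.Prime, p.Prime ∧ p ≤ y := fun p hp => by
    obtain ⟨h1, h2⟩ := Finset.mem_filter.1 hp
    exact ⟨h2, (Finset.mem_Icc.1 h1).2⟩
  have hone : ∀ p ∈ (Finset.Icc 1 y).filter Nat.Prime,
      ∑ a ∈ S.filter (fun a => p ^ g p ∣ c a), χ a ≤
        C * (1 + L₁) * R ^ (-δ) * M + L₂ * M ^ (1 - ξ) := by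
    intro p hp
    obtain ⟨hpp, hpy⟩ := hP p hp
    have hp0 : (0 : ℝ) < p := by exact_mod_cast hpp.pos
    obtain ⟨ε₁, ε₂, heq, h1, h2⟩ := hE.congruence (p ^ g p) (pow_pos hpp.pos _) (by
      push_cast
      refine (hgle p hpp).trans (le_trans ?_ hyR)
      exact mul_le_mul_of_nonneg_right (by exact_mod_cast hpy) (by linarith))
    have h3 : |ε₁| ≤ L₁ := by
      refine h1.trans (mul_le_of_le_one_right hL₁.le ?_)
      refine Finset.prod_le_one (fun q _ => sq_nonneg _) fun q hq => ?_
      simp only [Finset.mem_filter] at hq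
      have := hh.apply_prime_lt_one hB hq.2.1 hq.2.2.1
      exact pow_le_one₀ (by linarith) (by linarith [hh.nonneg q])
    have h4 : h (p ^ g p) ≤ C * R ^ (-δ) := by
      refine (hpow h hh p hpp (g p) (hg1 p hpp)).trans (mul_le_mul_of_nonneg_left ?_ hC.le)
      rw [show -(δ * (g p : ℝ)) = (g p : ℝ) * (-δ) by ring, Real.rpow_mul hp0.le, Real.rpow_natCast]
      exact Real.rpow_le_rpow_of_nonpos (by linarith) (hgR p hpp).le (by linarith)
    have h5 : h (p ^ g p) * M * (1 + ε₁) ≤ C * R ^ (-δ) * M * (1 + L₁) := by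
      have hε : 1 + ε₁ ≤ 1 + L₁ := by linarith [le_abs_self ε₁]
      refine (mul_le_mul_of_nonneg_left hε (mul_nonneg (hh.nonneg _) hM0.le)).trans ?_
      exact mul_le_mul_of_nonneg_right (mul_le_mul_of_nonneg_right h4 hM0.le) (by linarith)
    rw [heq]
    linarith [le_abs_self ε₂]
  calc ∑ a ∈ S', χ a
      ≤ ∑ a ∈ S', ∑ p ∈ (Finset.Icc 1 y).filter Nat.Prime, (if p ^ g p ∣ c a then χ a else 0) := by
        refine Finset.sum_le_sum fun a ha => ?_
        have hχ := hE.nonneg a (hS' ha)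
        obtain ⟨p, v, hpp, hpy, hpv, hRv⟩ := hbad a ha
        have hmem : p ∈ (Finset.Icc 1 y).filter Nat.Prime :=
          Finset.mem_filter.2 ⟨Finset.mem_Icc.2 ⟨hpp.pos, hpy⟩, hpp⟩
        have hdvd : p ^ g p ∣ c a :=
          (pow_dvd_pow p (hgmin p hpp v (by exact_mod_cast hRv))).trans hpv
        refine le_trans (le_of_eq ?_) (Finset.single_le_sum
          (f := fun p => if p ^ g p ∣ c a then χ a else 0)
          (fun q _ => by split_ifs <;> simp [hχ]) hmem)
        simp [hdvd]
    _ ≤ ∑ a ∈ S, ∑ p ∈ (Finset.Icc 1 y).filter Nat.Prime, (if p ^ g p ∣ c a then χ a else 0) := by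
        refine Finset.sum_le_sum_of_subset_of_nonneg hS' fun a ha _ =>
          Finset.sum_nonneg fun p _ => ?_
        have hχ := hE.nonneg a ha
        split_ifs <;> simp [hχ]
    _ = ∑ p ∈ (Finset.Icc 1 y).filter Nat.Prime, ∑ a ∈ S.filter (fun a => p ^ g p ∣ c a), χ a := by
        rw [Finset.sum_comm]
        refine Finset.sum_congr rfl fun p _ => ?_
        rw [Finset.sum_filter]
    _ ≤ ((Finset.Icc 1 y).filter Nat.Prime).card •
          (C * (1 + L₁) * R ^ (-δ) * M + L₂ * M ^ (1 - ξ)) := Finset.sum_le_card_nsmul _ _ _ hone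
    _ ≤ _ := by
        rw [nsmul_eq_mul]
        have hcard : (((Finset.Icc 1 y).filter Nat.Prime).card : ℝ) ≤ y := by
          have := Finset.card_filter_le (Finset.Icc 1 y) Nat.Prime
          rw [Nat.card_Icc, Nat.add_sub_cancel] at this
          exact_mod_cast this
        refine mul_le_mul_of_nonneg_right hcard ?_
        positivity

theorem sum_weight_le {θ ξ κ lam₁ lam₂ B K L₁ L₂ : ℝ} (hθ : 0 < θ) (hξ : 0 < ξ) (hB : 0 < B)
    (hL₁ : 0 < L₁) (hL₂ : 0 < L₂) {𝒜 : Type*} {S : Finset 𝒜} {χ : 𝒜 → ℝ} {c : 𝒜 → ℕ}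
    {M : ℝ} {h : ArithmeticFunction ℝ} (hh : IsDensityFunction κ lam₁ lam₂ B K h)
    (hE : IsEquidistributedAt θ ξ B L₁ L₂ S χ c M h) :
    ∑ a ∈ S, χ a ≤ (1 + L₁ + L₂) * M := by
  have hM := hE.one_le
  obtain ⟨ε₁, ε₂, heq, h1, h2⟩ := hE.congruence 1 le_rfl (by
    simpa using Real.one_le_rpow hM hθ.le)
  have h3 : |ε₁| ≤ L₁ := by
    refine h1.trans (mul_le_of_le_one_right hL₁.le ?_)
    refine Finset.prod_le_one (fun q _ => sq_nonneg _) fun q hq => ?_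
    simp only [Finset.mem_filter] at hq
    have := hh.apply_prime_lt_one hB hq.2.1 hq.2.2.1
    exact pow_le_one₀ (by linarith) (by linarith [hh.nonneg q])
  have h4 : M ^ (1 - ξ) ≤ M := by
    conv_rhs => rw [← Real.rpow_one M]
    exact Real.rpow_le_rpow_of_exponent_le hM (by linarith)
  have h5 : |ε₂| ≤ L₂ * M := h2.trans (mul_le_mul_of_nonneg_left h4 hL₂.le)
  simp only [one_dvd, Finset.filter_true, hh.isMultiplicative.map_one] at heq
  rw [heq]
  have h6 : M * ε₁ ≤ M * L₁ := mul_le_mul_of_nonneg_left ((le_abs_self _).trans h3) (by linarith)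
  linarith [le_abs_self ε₂]

/-- Any quantity `f 1 * M ^ (1 - τ)` is dominated by the right-hand side of the upper bound. -/
theorem exists_rpow_le_main {κ lam₁ lam₂ B K τ A : ℝ} (hB : 0 < B) (hτ : 0 < τ)
    {f : ArithmeticFunction ℝ} (hf : ∀ ε : ℝ, 0 < ε → ∃ C : ℝ, 0 < C ∧ IsSubmultClass A ε C f) :
    ∃ C : ℝ, 0 < C ∧ ∀ (h : ArithmeticFunction ℝ), IsDensityFunction κ lam₁ lam₂ B K h →
      ∀ M : ℝ, 1 ≤ M → f 1 * M ^ (1 - τ) ≤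
        C * (M * sieveProduct B M h * ∑ n ∈ Finset.Icc 1 ⌊M⌋₊, f n * h n) := by
  obtain ⟨C, hC, hle⟩ := exists_le_sieveProduct (κ := κ) (lam₁ := lam₁) (lam₂ := lam₂)
    (K := K) hB hτ
  obtain ⟨Cf, -, hfC⟩ := hf 1 one_pos
  refine ⟨C⁻¹, by positivity, fun h hh M hM => ?_⟩
  have hM0 : 0 < M := by linarith
  have h1 : f 1 ≤ ∑ n ∈ Finset.Icc 1 ⌊M⌋₊, f n * h n := by
    have := Finset.single_le_sum (f := fun n => f n * h n) (s := Finset.Icc 1 ⌊M⌋₊)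
      (fun n _ => mul_nonneg (hfC.nonneg n) (hh.nonneg n))
      (Finset.mem_Icc.2 ⟨le_rfl, Nat.le_floor (by simpa using hM)⟩)
    simpa [hh.isMultiplicative.map_one] using this
  have h2 := hle h hh M hM
  have hf1 := hfC.nonneg 1
  have e : M ^ (1 - τ) = M * M ^ (-τ) := by
    rw [sub_eq_add_neg, Real.rpow_add hM0, Real.rpow_one]
  have h3 : M ^ (-τ) ≤ C⁻¹ * sieveProduct B M h := by
    rw [inv_mul_eq_div, le_div_iff₀ hC]; linarith
  have hr : 0 ≤ M ^ (-τ) := by positivity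
  rw [e]
  calc f 1 * (M * M ^ (-τ)) = M * (M ^ (-τ) * f 1) := by ring
    _ ≤ M * ((C⁻¹ * sieveProduct B M h) * ∑ n ∈ Finset.Icc 1 ⌊M⌋₊, f n * h n) := by
        refine mul_le_mul_of_nonneg_left (mul_le_mul h3 h1 hf1 (hr.trans h3)) hM0.le
    _ = _ := by ring

/-! ### One class of the factorisation -/

set_option maxHeartbeats 1000000 in
/-- The contribution of the `a` for which `c a = b * d` with `b ≤ M ^ x`, all primes dividing `d`
larger than `M ^ (η / (s + 1))`, and, for `s ≠ 0`, `b > M ^ (x / 2)` free of primes larger than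
`M ^ (η / s)`. The sieve loses a factor exponential in `s`, but Rankin's method gains an
exponential with any prescribed base. -/
theorem exists_sum_class_le {θ ξ κ lam₁ lam₂ B K L₁ L₂ A x η : ℝ} (hB : 0 < B)
    (hlam₁ : 0 < lam₁) (hlam₂ : 0 < lam₂) (hL₁ : 0 < L₁) (hL₂ : 0 < L₂) (hA : 1 ≤ A)
    (hx : 0 < x) (hx1 : x ≤ 1) (hη : 0 < η) (hη1 : η ≤ 1) (hxη : x + 4 * η ≤ θ) (k : ℕ)
    {f : ArithmeticFunction ℝ}
    (hf : ∀ ε : ℝ, 0 < ε → ∃ C : ℝ, 0 < C ∧ IsSubmultClass A ε C f) :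
    ∃ Q₀ : ℕ, 2 ≤ Q₀ ∧ ∃ C : ℝ, 0 < C ∧ ∀ {𝒜 : Type*} (S : Finset 𝒜) (χ : 𝒜 → ℝ) (c : 𝒜 → ℕ)
      (M : ℝ) (h : ArithmeticFunction ℝ), IsDensityFunction κ lam₁ lam₂ B K h →
      IsEquidistributedAt θ ξ B L₁ L₂ S χ c M h → 2 ≤ M →
      ∀ s : ℕ, s * Real.log Q₀ ≤ η * Real.log M → ∀ S' ⊆ S,
      (∀ a ∈ S', ∃ b d : ℕ, c a = b * d ∧ b.Coprime d ∧ 0 < b ∧ 0 < d ∧ (b : ℝ) ≤ M ^ x ∧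
        (s ≠ 0 → M ^ (x / 2) < b) ∧ (∀ p : ℕ, p.Prime → p ∣ b → (p : ℝ) ^ s ≤ M ^ η) ∧
        (∀ p : ℕ, p.Prime → p ∣ d → M ^ (η / (s + 1)) < p) ∧ Ω d ≤ k * (s + 1)) →
      ∑ a ∈ S', χ a * f (c a) ≤ (1 / 2) ^ s *
        (C * (M * sieveProduct B M h * ∑ n ∈ Finset.Icc 1 ⌊M⌋₊, f n * h n) +
          C * (f 1 * M ^ (1 - ξ + 3 * x + 4 * η))) := by
  obtain ⟨D, hD, hDp⟩ := exists_exp_neg_div_le_one_sub hB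
  obtain ⟨Cs, hCs, hsieve⟩ := exists_sieve_upper_bound (θ := θ) (ξ := ξ) (κ := κ) (lam₁ := lam₁)
    (lam₂ := lam₂) (K := K) (L₂ := L₂) hB hL₁
  obtain ⟨Cf, hCf, hfC⟩ := hf 1 one_pos
  set g : ℝ := A ^ k * Real.exp (3 * D / η) with hg
  have hAk : 1 ≤ A ^ k := one_le_pow₀ hA
  have hg1 : 1 ≤ g := by
    have : 1 ≤ Real.exp (3 * D / η) := Real.one_le_exp (by positivity)
    nlinarith
  -- The loss from `A ^ Ω d` and from the shorter sieve is `g ^ (s + 1)`. The shift is chosen so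
  -- that Rankin's method gains `(2 * g) ^ s`.
  set C' : ℝ := 2 * Real.log (2 * g) / x with hC'
  have hC'0 : 0 < C' := by
    have : 0 < Real.log (2 * g) := Real.log_pos (by linarith)
    positivity
  obtain ⟨CR, hCR, hrankin⟩ := exists_rankin_bound κ K hB hlam₁ hlam₂ hA
    (c₁ := C' * η + lam₁) (by positivity) hf
  have hl2A : 0 < Real.log (2 * A ^ k) := Real.log_pos (by linarith)
  -- A lower bound for `log Q₀`. The second term gives `β ≤ lam₁ / 8`, the third keeps the sum of
  -- the sieve remainders, of size `(2 * A ^ k) ^ s`, below `M ^ x`.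
  set t : ℝ := 1 + 8 * (C' * η) / lam₁ + η * Real.log (2 * A ^ k) / x with ht
  have ht0 : 0 < t := by positivity
  have ht1 : C' * η ≤ lam₁ / 8 * t := by
    have e : lam₁ / 8 * t = lam₁ / 8 + C' * η + lam₁ / 8 * (η * Real.log (2 * A ^ k) / x) := by
      rw [ht]; field_simp
    rw [e]
    have : 0 < lam₁ / 8 * (η * Real.log (2 * A ^ k) / x) := by positivity
    linarith
  have ht2 : η * Real.log (2 * A ^ k) ≤ x * t := by
    have e : x * t = x + x * (8 * (C' * η) / lam₁) + η * Real.log (2 * A ^ k) := by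
      rw [ht]; field_simp
    rw [e]
    have : 0 < x * (8 * (C' * η) / lam₁) := by positivity
    linarith
  have ht3 : 1 ≤ t := by
    have : 0 < 8 * (C' * η) / lam₁ + η * Real.log (2 * A ^ k) / x := by positivity
    rw [ht]; linarith
  set Q₀ : ℕ := ⌈Real.exp t⌉₊ with hQ₀
  have hQexp : Real.exp t ≤ Q₀ := Nat.le_ceil _
  have hQ2 : 2 ≤ Q₀ := by
    have := Real.add_one_le_exp t
    exact_mod_cast (show (2 : ℝ) ≤ Q₀ by linarith)
  have hlogQ : t ≤ Real.log Q₀ := by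
    rw [Real.le_log_iff_exp_le (by linarith [Real.exp_pos t])]; exact hQexp
  refine ⟨Q₀, hQ2, Cs * CR * g + A ^ k * L₂ * Cf, by positivity, ?_⟩
  intro 𝒜 S χ c M h hh hE hM2 s hs S' hS' hclass
  have hM0 : 0 < M := by linarith
  have hM1 : 1 ≤ M := by linarith
  set lM := Real.log M with hlM
  have hlM0 : 0 < lM := Real.log_pos (by linarith)
  have hlog4 : Real.log 4 ≤ 2 * lM := by
    rw [show (4 : ℝ) = 2 ^ 2 by norm_num, Real.log_pow]
    have := Real.log_le_log two_pos hM2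
    push_cast; linarith
  have hst : s * t ≤ η * lM := (mul_le_mul_of_nonneg_left hlogQ (Nat.cast_nonneg s)).trans hs
  -- The shift in Rankin's method.
  set β : ℝ := C' * s / lM with hβ
  have hβ0 : 0 ≤ β := by positivity
  have hβlM : β * lM = C' * s := by rw [hβ]; field_simp
  have hβ1 : β ≤ lam₁ / 8 := by
    rw [hβ, div_le_iff₀ hlM0]
    have h1 : C' * (s * t) ≤ C' * (η * lM) := mul_le_mul_of_nonneg_left hst hC'0.le
    have h2 : C' * η * lM ≤ lam₁ / 8 * t * lM := mul_le_mul_of_nonneg_right ht1 hlM0.le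
    have h3 : (C' * s) * t ≤ (lam₁ / 8 * lM) * t := by linarith
    exact le_of_mul_le_mul_right h3 ht0
  set Y : ℝ := M ^ (η / (s + 1)) with hY
  have hs1 : (0 : ℝ) < s + 1 := by positivity
  have hY1 : 1 < Y := Real.one_lt_rpow (by linarith) (by positivity)
  have hηs : η / (s + 1) ≤ η := div_le_self hη.le (by linarith [(Nat.cast_nonneg s : (0 : ℝ) ≤ s)])
  have hYη : Y ≤ M ^ η := Real.rpow_le_rpow_of_exponent_le hM1 hηs
  have hYM : Y ≤ M := by
    conv_rhs => rw [← Real.rpow_one M]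
    exact Real.rpow_le_rpow_of_exponent_le hM1 (hηs.trans hη1)
  have hlY : Real.log Y = η / (s + 1) * lM := Real.log_rpow hM0 _
  have hratio : (lM + Real.log 4) / Real.log Y ≤ 3 / η * (s + 1) := by
    rw [hlY, div_le_iff₀ (by positivity)]
    have : 3 / η * (s + 1) * (η / (s + 1) * lM) = 3 * lM := by field_simp
    rw [this]; linarith
  set y := ⌊Y⌋₊ with hy
  have hy1 : 1 ≤ y := Nat.le_floor (by simpa using hY1.le)
  have hyY : (y : ℝ) ≤ Y := Nat.floor_le (by linarith)
  have hy4 : (y : ℝ) ^ 4 ≤ M ^ (4 * η) := by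
    calc (y : ℝ) ^ 4 ≤ (M ^ η) ^ 4 := by gcongr; exact hyY.trans hYη
      _ = M ^ (4 * η) := by
        rw [← Real.rpow_natCast, ← Real.rpow_mul hM0.le]; congr 1; push_cast; ring
  set N := ⌊M ^ x⌋₊ with hN
  have hMx1 : 1 ≤ M ^ x := Real.one_le_rpow hM1 hx.le
  have hNx : (N : ℝ) ≤ M ^ x := Nat.floor_le (by linarith)
  have hNM : N ≤ ⌊M⌋₊ := by
    apply Nat.floor_le_floor
    conv_rhs => rw [← Real.rpow_one M]
    exact Real.rpow_le_rpow_of_exponent_le hM1 hx1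
  classical
  set ℬ := (Finset.Icc 1 N).filter (fun b : ℕ => (s ≠ 0 → M ^ (x / 2) < b) ∧
    ∀ p : ℕ, p.Prime → p ∣ b → (p : ℝ) ^ s ≤ M ^ η) with hℬ
  have hbB : ∀ b ∈ ℬ, 1 ≤ b ∧ (b : ℝ) ≤ M ^ x := fun b hb => by
    obtain ⟨h1, h2⟩ := Finset.mem_Icc.1 (Finset.mem_filter.1 hb).1
    exact ⟨h1, le_trans (by exact_mod_cast h2) hNx⟩
  set Q : ℕ → Finset ℕ := fun b =>
    (Finset.Icc 1 y).filter (fun p : ℕ => p.Prime ∧ B < (p : ℝ) ∧ ¬ p ∣ b) with hQ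
  set v : ℕ → ℝ := fun b => ∏ p ∈ b.primeFactors.filter (fun p : ℕ => B < p), (1 - h p)⁻¹ with hv
  have hv0 : ∀ b, 0 ≤ v b := fun b => Finset.prod_nonneg fun p hp => by
    obtain ⟨hp1, hp2⟩ := Finset.mem_filter.1 hp
    have := hh.apply_prime_lt_one hB (Nat.prime_of_mem_primeFactors hp1) hp2
    exact inv_nonneg.2 (by linarith)
  set SP := sieveProduct B M h with hSP
  have hSP0 : 0 < SP := hh.prod_one_sub_pos hB fun p hp => (Finset.mem_filter.1 hp).2
  set F₀ := ∑ n ∈ Finset.Icc 1 ⌊M⌋₊, f n * h n with hF₀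
  have hfh0 : ∀ n, 0 ≤ f n * h n := fun n => mul_nonneg (hfC.nonneg n) (hh.nonneg n)
  -- Sorting the elements by `b`.
  have hsort : ∑ a ∈ S', χ a * f (c a) ≤ ∑ b ∈ ℬ, A ^ (k * (s + 1)) * f b *
      ∑ a ∈ S.filter (fun a => b ∣ c a ∧ ∀ p ∈ Q b, ¬ p ∣ c a), χ a := by
    have hnn : ∀ a ∈ S, ∀ b, 0 ≤ (if b ∣ c a ∧ ∀ p ∈ Q b, ¬ p ∣ c a then
        A ^ (k * (s + 1)) * f b * χ a else 0) := fun a ha b => by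
      split_ifs
      · exact mul_nonneg (mul_nonneg (by positivity) (hfC.nonneg b)) (hE.nonneg a ha)
      · exact le_rfl
    calc ∑ a ∈ S', χ a * f (c a) ≤ ∑ a ∈ S', ∑ b ∈ ℬ, (if b ∣ c a ∧ ∀ p ∈ Q b, ¬ p ∣ c a then
          A ^ (k * (s + 1)) * f b * χ a else 0) := by
          refine Finset.sum_le_sum fun a ha => ?_
          obtain ⟨b, d, hcbd, hcop, hb0, hd0, hbx, hbs, hbp, hdp, hΩ⟩ := hclass a ha
          have hbmem : b ∈ ℬ := Finset.mem_filter.2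
            ⟨Finset.mem_Icc.2 ⟨hb0, Nat.le_floor hbx⟩, hbs, hbp⟩
          refine le_trans ?_ (Finset.single_le_sum (fun b _ => hnn a (hS' ha) b) hbmem)
          rw [if_pos]
          · have h1 : f (c a) ≤ A ^ (k * (s + 1)) * f b := by
              rw [hcbd, mul_comm (A ^ _)]
              refine (hfC.mul_le b d hb0 hd0 hcop).trans
                (mul_le_mul_of_nonneg_left ?_ (hfC.nonneg b))
              exact (min_le_left _ _).trans (pow_le_pow_right₀ hA hΩ)
            have := mul_le_mul_of_nonneg_left h1 (hE.nonneg a (hS' ha))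
            linarith
          · refine ⟨hcbd ▸ dvd_mul_right b d, fun p hp hpc => ?_⟩
            obtain ⟨hpI, hpp, hpB, hpb⟩ := Finset.mem_filter.1 hp
            rw [hcbd] at hpc
            have hpd := ((hpp.dvd_mul).1 hpc).resolve_left hpb
            have h1 := hdp p hpp hpd
            have h2 : (p : ℝ) ≤ y := by exact_mod_cast (Finset.mem_Icc.1 hpI).2
            linarith
      _ ≤ ∑ a ∈ S, ∑ b ∈ ℬ, (if b ∣ c a ∧ ∀ p ∈ Q b, ¬ p ∣ c a then
          A ^ (k * (s + 1)) * f b * χ a else 0) :=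
          Finset.sum_le_sum_of_subset_of_nonneg hS' fun a ha _ =>
            Finset.sum_nonneg fun b _ => hnn a ha b
      _ = _ := by
          rw [Finset.sum_comm]
          refine Finset.sum_congr rfl fun b _ => ?_
          rw [Finset.mul_sum, Finset.sum_filter]
  -- The sieve, for each `b`.
  have hexps : Real.exp (D * (3 / η * (s + 1))) = Real.exp (3 * D / η) ^ (s + 1) := by
    rw [← Real.exp_nat_mul]; congr 1; push_cast; ring
  have hb_bound : ∀ b ∈ ℬ, A ^ (k * (s + 1)) * f b *
      ∑ a ∈ S.filter (fun a => b ∣ c a ∧ ∀ p ∈ Q b, ¬ p ∣ c a), χ a ≤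
      Cs * (M * SP) * g ^ (s + 1) * (f b * h b * v b) +
        A ^ (k * (s + 1)) * (f 1 * Cf * M ^ x) * (L₂ * M ^ (1 - ξ) * M ^ (4 * η)) := by
    intro b hb
    obtain ⟨hb1, hbx⟩ := hbB b hb
    have hb4 : ((b * y ^ 4 : ℕ) : ℝ) ≤ M ^ θ := by
      push_cast
      calc (b : ℝ) * (y : ℝ) ^ 4 ≤ M ^ x * M ^ (4 * η) := by gcongr
        _ = M ^ (x + 4 * η) := (Real.rpow_add hM0 _ _).symm
        _ ≤ M ^ θ := Real.rpow_le_rpow_of_exponent_le hM1 hxη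
    have h1 := hsieve S χ c M h hh hE b y (Q b) hb1 hy1 (hyY.trans hYM) hb4 fun p hp => by
      obtain ⟨hpI, hpp, hpB, hpb⟩ := Finset.mem_filter.1 hp
      exact ⟨hpp, hpB, (Finset.mem_Icc.1 hpI).2, hpb⟩
    have h2 : ∏ p ∈ Q b, (1 - h p) ≤ SP * v b * Real.exp (3 * D / η) ^ (s + 1) := by
      refine (prod_one_sub_le_sieveProduct_mul hB hD hDp hh hY1 hM1 (b := b) (by omega)).trans ?_
      rw [← hexps]
      refine mul_le_mul_of_nonneg_left (Real.exp_le_exp.2 ?_) (mul_nonneg hSP0.le (hv0 b))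
      exact mul_le_mul_of_nonneg_left hratio hD.le
    have hMh : 0 ≤ Cs * (M * h b) := mul_nonneg hCs.le (mul_nonneg hM0.le (hh.nonneg b))
    have h3 := mul_le_mul_of_nonneg_left h2 hMh
    have h4 : L₂ * M ^ (1 - ξ) * (y : ℝ) ^ 4 ≤ L₂ * M ^ (1 - ξ) * M ^ (4 * η) := by gcongr
    have hfb : f b ≤ f 1 * Cf * M ^ x := by
      have h5 := hfC.mul_le 1 b one_pos hb1 (Nat.coprime_one_left b)
      rw [one_mul] at h5
      refine h5.trans ?_
      rw [mul_assoc]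
      refine mul_le_mul_of_nonneg_left ((min_le_right _ _).trans ?_) (hfC.nonneg 1)
      rw [Real.rpow_one]
      gcongr
    have hAf : 0 ≤ A ^ (k * (s + 1)) * f b := mul_nonneg (by positivity) (hfC.nonneg b)
    have h6 := mul_le_mul_of_nonneg_left h1 hAf
    have h7 := mul_le_mul_of_nonneg_left h3 hAf
    have h8 := mul_le_mul_of_nonneg_left h4 hAf
    have h9 : A ^ (k * (s + 1)) * f b * (L₂ * M ^ (1 - ξ) * M ^ (4 * η)) ≤
        A ^ (k * (s + 1)) * (f 1 * Cf * M ^ x) * (L₂ * M ^ (1 - ξ) * M ^ (4 * η)) := by gcongr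
    have e1 : A ^ (k * (s + 1)) * f b *
        (Cs * (M * h b) * (SP * v b * Real.exp (3 * D / η) ^ (s + 1))) =
        Cs * (M * SP) * g ^ (s + 1) * (f b * h b * v b) := by
      rw [hg, mul_pow, pow_mul]; ring
    rw [e1] at h7
    linarith
  -- Rankin's method, for the main term.
  have hrank : ∑ b ∈ ℬ, f b * h b * v b ≤ (1 / (2 * g)) ^ s * (CR * F₀) := by
    set P := (Finset.Icc 1 N).filter (fun p : ℕ => p.Prime ∧ (p : ℝ) ^ s ≤ M ^ η) with hP
    have hPlog : ∀ p ∈ P, p.Prime ∧ s * Real.log p ≤ η * lM := fun p hp => by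
      obtain ⟨-, hpp, hps⟩ := Finset.mem_filter.1 hp
      have := Real.log_le_log (pow_pos (by exact_mod_cast hpp.pos) s) hps
      rw [Real.log_pow, Real.log_rpow hM0] at this
      exact ⟨hpp, this⟩
    have hP1 : ∀ p ∈ P, p.Prime ∧ β * Real.log p ≤ C' * η + lam₁ := fun p hp => by
      refine ⟨(hPlog p hp).1, ?_⟩
      have h1 : β * Real.log p = C' * (s * Real.log p) / lM := by rw [hβ]; ring
      have h2 : C' * (s * Real.log p) / lM ≤ C' * η := by
        rw [div_le_iff₀ hlM0, mul_assoc]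
        exact mul_le_mul_of_nonneg_left (hPlog p hp).2 hC'0.le
      linarith
    have hP2 : β * ∑ p ∈ P, Real.log p / p ≤ C' * η + lam₁ := by
      rcases Nat.eq_zero_or_pos s with h0 | hspos
      · have : β = 0 := by rw [hβ, h0]; simp
        rw [this, zero_mul]; positivity
      have hs0 : (0 : ℝ) < s := by exact_mod_cast hspos
      have h1 := sum_log_div_prime_le (S := P) (x := M ^ (η / s))
        (Real.one_le_rpow hM1 (by positivity)) fun p hp => by
          refine ⟨(hPlog p hp).1, ?_⟩
          have hp0 : (0 : ℝ) < p := by exact_mod_cast (hPlog p hp).1.pos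
          rw [← Real.log_le_log_iff hp0 (by positivity), Real.log_rpow hM0, div_mul_eq_mul_div,
            le_div_iff₀ hs0, mul_comm]
          exact (hPlog p hp).2
      rw [Real.log_rpow hM0] at h1
      have h2 := mul_le_mul_of_nonneg_left h1 hβ0
      have h3 : β * (η / s * lM) = C' * η := by rw [hβ]; field_simp
      have h4 : Real.log 4 ≤ 3 := by
        have := Real.log_le_sub_one_of_pos (show (0 : ℝ) < 4 by norm_num)
        linarith
      have h5 : β * Real.log 4 ≤ lam₁ / 8 * 3 :=
        mul_le_mul hβ1 h4 (Real.log_nonneg (by norm_num)) (by positivity)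
      rw [mul_add, h3] at h2
      linarith
    have hR := hrankin h hh β hβ0 hβ1 P hP1 hP2 N
    have hsub : ℬ ⊆ (Finset.Icc 1 N).filter (fun n => n.primeFactors ⊆ P) := by
      intro b hb
      obtain ⟨hbI, hbs, hbp⟩ := Finset.mem_filter.1 hb
      refine Finset.mem_filter.2 ⟨hbI, fun p hp => ?_⟩
      have hpp := Nat.prime_of_mem_primeFactors hp
      have hpb := Nat.dvd_of_mem_primeFactors hp
      obtain ⟨hb1, hbN⟩ := Finset.mem_Icc.1 hbI
      exact Finset.mem_filter.2 ⟨Finset.mem_Icc.2 ⟨hpp.pos, (Nat.le_of_dvd hb1 hpb).trans hbN⟩,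
        hpp, hbp p hpp hpb⟩
    have hgain : ((1 : ℝ) / (2 * g)) ^ s = M ^ (-(x / 2 * β)) := by
      rw [Real.rpow_def_of_pos hM0]
      have e1 : Real.log M * -(x / 2 * β) = s * (-Real.log (2 * g)) := by
        have : Real.log M * -(x / 2 * β) = -(x / 2 * (β * lM)) := by rw [hlM]; ring
        rw [this, hβlM, hC']; field_simp
      rw [e1, Real.exp_nat_mul, Real.exp_neg, Real.exp_log (by linarith), one_div]
    calc ∑ b ∈ ℬ, f b * h b * v b
        ≤ ∑ b ∈ ℬ, (1 / (2 * g)) ^ s * (f b * h b * ((b : ℝ) ^ β * v b)) := by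
          refine Finset.sum_le_sum fun b hb => ?_
          have hone : 1 ≤ (1 / (2 * g)) ^ s * (b : ℝ) ^ β := by
            rw [hgain]
            rcases Nat.eq_zero_or_pos s with h0 | hspos
            · have : β = 0 := by rw [hβ, h0]; simp
              simp [this]
            have h1 := ((Finset.mem_filter.1 hb).2.1 hspos.ne').le
            calc (1 : ℝ) = M ^ (-(x / 2 * β)) * (M ^ (x / 2)) ^ β := by
                  rw [← Real.rpow_mul hM0.le, ← Real.rpow_add hM0, neg_add_cancel, Real.rpow_zero]
              _ ≤ _ := by gcongr
          have := le_mul_of_one_le_left (mul_nonneg (hfh0 b) (hv0 b)) hone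
          linarith
      _ = (1 / (2 * g)) ^ s * ∑ b ∈ ℬ, f b * h b * ((b : ℝ) ^ β * v b) := by rw [Finset.mul_sum]
      _ ≤ (1 / (2 * g)) ^ s * (CR * F₀) := by
          refine mul_le_mul_of_nonneg_left ?_ (by positivity)
          refine (Finset.sum_le_sum_of_subset_of_nonneg hsub fun n _ _ =>
            mul_nonneg (hfh0 n) (mul_nonneg (by positivity) (hv0 n))).trans (hR.trans ?_)
          refine mul_le_mul_of_nonneg_left ?_ hCR.le
          exact Finset.sum_le_sum_of_subset_of_nonneg (Finset.Icc_subset_Icc_right hNM)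
            fun n _ _ => hfh0 n
  have hF₀0 : 0 ≤ F₀ := Finset.sum_nonneg fun n _ => hfh0 n
  have hf1 := hfC.nonneg 1
  have hcard : (ℬ.card : ℝ) ≤ M ^ x := by
    have h1 : ℬ.card ≤ N := by
      have := Finset.card_filter_le (Finset.Icc 1 N) (fun b : ℕ => (s ≠ 0 → M ^ (x / 2) < b) ∧
        ∀ p : ℕ, p.Prime → p ∣ b → (p : ℝ) ^ s ≤ M ^ η)
      rwa [Nat.card_Icc, Nat.add_sub_cancel] at this
    exact le_trans (by exact_mod_cast h1) hNx
  have hApow : A ^ (k * (s + 1)) ≤ (1 / 2) ^ s * (A ^ k * M ^ x) := by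
    have h1 : (2 * A ^ k) ^ s ≤ M ^ x := by
      rw [← Real.log_le_log_iff (by positivity) (by positivity), Real.log_pow, Real.log_rpow hM0]
      have h2 : (s * t) * Real.log (2 * A ^ k) ≤ (η * lM) * Real.log (2 * A ^ k) :=
        mul_le_mul_of_nonneg_right hst hl2A.le
      have h3 := mul_le_mul_of_nonneg_right ht2 hlM0.le
      have h4 : (s * Real.log (2 * A ^ k)) * t ≤ (x * lM) * t := by linarith
      exact le_of_mul_le_mul_right h4 ht0
    calc A ^ (k * (s + 1)) = (1 / 2) ^ s * (A ^ k * (2 * A ^ k) ^ s) := by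
          rw [mul_pow, pow_mul, pow_succ, one_div, inv_pow]
          field_simp
      _ ≤ _ := by gcongr
  have hpow : ∀ z : ℝ, 0 < z → z ^ (s + 1) * (1 / (2 * z)) ^ s = z * (1 / 2) ^ s := fun z hz => by
    rw [div_pow, div_pow, mul_pow, pow_succ, one_pow]; field_simp
  have hmain : Cs * (M * SP) * g ^ (s + 1) * ∑ b ∈ ℬ, f b * h b * v b ≤
      (1 / 2) ^ s * (Cs * CR * g * (M * SP * F₀)) := by
    calc _ ≤ Cs * (M * SP) * g ^ (s + 1) * ((1 / (2 * g)) ^ s * (CR * F₀)) := by gcongr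
      _ = Cs * (M * SP) * (g ^ (s + 1) * (1 / (2 * g)) ^ s) * (CR * F₀) := by ring
      _ = _ := by rw [hpow g (by linarith)]; ring
  have herr : (ℬ.card : ℝ) *
      (A ^ (k * (s + 1)) * (f 1 * Cf * M ^ x) * (L₂ * M ^ (1 - ξ) * M ^ (4 * η))) ≤
      (1 / 2) ^ s * (A ^ k * L₂ * Cf * (f 1 * M ^ (1 - ξ + 3 * x + 4 * η))) := by
    calc _ ≤ M ^ x * (((1 / 2) ^ s * (A ^ k * M ^ x)) * (f 1 * Cf * M ^ x) *
          (L₂ * M ^ (1 - ξ) * M ^ (4 * η))) := by gcongr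
      _ = _ := by
        rw [Real.rpow_add hM0, Real.rpow_add hM0, show 3 * x = x + x + x by ring,
          Real.rpow_add hM0, Real.rpow_add hM0]
        ring
  refine hsort.trans ((Finset.sum_le_sum hb_bound).trans ?_)
  rw [Finset.sum_add_distrib, ← Finset.mul_sum, Finset.sum_const, nsmul_eq_mul]
  refine (add_le_add hmain herr).trans ?_
  rw [← mul_add]
  refine mul_le_mul_of_nonneg_left ?_ (by positivity)
  have z1 : 0 ≤ M * SP * F₀ := by positivity
  have z2 : 0 ≤ f 1 * M ^ (1 - ξ + 3 * x + 4 * η) := by positivity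
  have z3 : 0 ≤ Cs * CR * g := by positivity
  have z4 : 0 ≤ A ^ k * L₂ * Cf := by positivity
  nlinarith [mul_nonneg z4 z1, mul_nonneg z3 z2]

/-! ### The upper bound -/

/-- Classification of the integers `c ≤ M ^ (α + 1)`: either `c` has a large power of a small
prime as a divisor, or it factors as in `exists_sum_class_le` for some `s`. -/
theorem exists_prime_pow_or_class {x η α M : ℝ} (hx : 0 < x) (hη : 0 < η)
    (hM : 1 < M) {Q₀ : ℕ} (hQ₀ : 2 ≤ Q₀) {c : ℕ} (hc : 0 < c) (hcM : (c : ℝ) ≤ M ^ (α + 1)) :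
    (∃ p v : ℕ, p.Prime ∧ p ≤ ⌊M ^ η⌋₊ ∧ p ^ v ∣ c ∧ M ^ (x / 2) < ((p ^ v : ℕ) : ℝ)) ∨
    (∃ p v : ℕ, p.Prime ∧ p ≤ Q₀ ∧ p ^ v ∣ c ∧ M ^ (x / (2 * Q₀)) < ((p ^ v : ℕ) : ℝ)) ∨
    ∃ s : ℕ, s * Real.log Q₀ ≤ η * Real.log M ∧ ∃ b d : ℕ, c = b * d ∧ b.Coprime d ∧
      0 < b ∧ 0 < d ∧ (b : ℝ) ≤ M ^ x ∧ (s ≠ 0 → M ^ (x / 2) < b) ∧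
      (∀ p : ℕ, p.Prime → p ∣ b → (p : ℝ) ^ s ≤ M ^ η) ∧
      (∀ p : ℕ, p.Prime → p ∣ d → M ^ (η / (s + 1)) < p) ∧ Ω d ≤ ⌈(α + 1) / η⌉₊ * (s + 1) := by
  have hM0 : 0 < M := by linarith
  have hlM : 0 < Real.log M := Real.log_pos hM
  have hQ0 : (0 : ℝ) < Q₀ := by exact_mod_cast (by omega : 0 < Q₀)
  have hΩ : ∀ (s d : ℕ), 0 < d → d ∣ c → (∀ p : ℕ, p.Prime → p ∣ d → M ^ (η / (s + 1)) < p) →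
      Ω d ≤ ⌈(α + 1) / η⌉₊ * (s + 1) := by
    intro s d hd hdc hp
    have hs1 : (0 : ℝ) < s + 1 := by positivity
    have h1 := pow_cardFactors_le (by positivity) hd fun p hpp hpd => (hp p hpp hpd).le
    have h2 : (d : ℝ) ≤ M ^ (α + 1) := le_trans (by exact_mod_cast Nat.le_of_dvd hc hdc) hcM
    have h3 := Real.log_le_log (by positivity) (h1.trans h2)
    rw [Real.log_pow, Real.log_rpow hM0, Real.log_rpow hM0, ← mul_assoc] at h3
    have h4 := le_of_mul_le_mul_right h3 hlM
    have h5 : (Ω d : ℝ) ≤ (α + 1) / η * (s + 1) := by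
      rw [div_mul_eq_mul_div, le_div_iff₀ hη]
      rw [← mul_div_assoc, div_le_iff₀ hs1] at h4
      exact h4
    have h6 : (Ω d : ℝ) ≤ ((⌈(α + 1) / η⌉₊ * (s + 1) : ℕ) : ℝ) := by
      push_cast
      exact h5.trans (mul_le_mul_of_nonneg_right (Nat.le_ceil _) hs1.le)
    exact_mod_cast h6
  have hMη : 0 ≤ M ^ η := by positivity
  rcases primePartBelow_le_or_exists_prime c ⌊M ^ η⌋₊ (Real.one_le_rpow hM.le hx.le) with
    hle | ⟨q, hq, hqz, hqc, hbX, hXb⟩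
  · right; right
    obtain ⟨d, hcd, hcop, hdp⟩ := exists_eq_primePartBelow_mul (⌊M ^ η⌋₊ + 1) hc
    have hd0 : 0 < d := Nat.pos_of_ne_zero fun h => by rw [h, mul_zero] at hcd; omega
    have hdp' : ∀ p : ℕ, p.Prime → p ∣ d → M ^ (η / ((0 : ℕ) + 1 : ℝ)) < p := fun p hp hpd => by
      have := Nat.lt_of_floor_lt (Nat.lt_of_succ_le (hdp p hp hpd))
      simpa using this
    refine ⟨0, by simp; positivity, primePartBelow (⌊M ^ η⌋₊ + 1) c, d, hcd, hcop,
      primePartBelow_pos _ _, hd0, hle, fun h => absurd rfl h, fun p _ _ => ?_, hdp',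
      hΩ 0 d hd0 (Dvd.intro_left _ hcd.symm) hdp'⟩
    simpa using Real.one_le_rpow hM.le hη.le
  obtain ⟨d, hcd, hcop, hdp⟩ := exists_eq_primePartBelow_mul q hc
  have hd0 : 0 < d := Nat.pos_of_ne_zero fun h => by rw [h, mul_zero] at hcd; omega
  set b := primePartBelow q c with hb
  have hb0 : 0 < b := primePartBelow_pos _ _
  have hbc : b ∣ c := Dvd.intro _ hcd.symm
  rcases le_or_gt (b : ℝ) (M ^ (x / 2)) with hbs | hbl
  · left
    refine ⟨q, c.factorization q, hq, hqz, Nat.ordProj_dvd c q, ?_⟩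
    have h1 : M ^ x = M ^ (x / 2) * M ^ (x / 2) := by rw [← Real.rpow_add hM0]; congr 1; ring
    rw [h1] at hXb
    have h2 := hXb.trans_le (mul_le_mul_of_nonneg_right hbs (Nat.cast_nonneg _))
    exact lt_of_mul_lt_mul_left h2 (by positivity)
  right
  rcases le_or_gt q Q₀ with hqQ | hqQ
  · left
    have hpow : (M ^ (x / (2 * Q₀))) ^ Q₀ = M ^ (x / 2) := by
      rw [← Real.rpow_natCast, ← Real.rpow_mul hM0.le]; congr 1; field_simp
    obtain ⟨p, hp, hpQ, hpR⟩ := exists_lt_prime_pow_of_smooth (n := Q₀) hb0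
      (Real.one_le_rpow hM.le (show 0 ≤ x / (2 * Q₀) by positivity))
      (fun p hp hpb => (lt_of_prime_dvd_primePartBelow hp hpb).trans_le hqQ) (by rwa [hpow])
    exact ⟨p, _, hp, hpQ.le, (Nat.ordProj_dvd b p).trans hbc, hpR⟩
  · right
    have hz0 : ⌊M ^ η⌋₊ ≠ 0 := by have := hq.pos; omega
    set s := Nat.log q ⌊M ^ η⌋₊ with hs
    have hqs : (q : ℝ) ^ s ≤ M ^ η := by
      refine le_trans ?_ (Nat.floor_le hMη)
      exact_mod_cast Nat.pow_log_le_self q hz0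
    have hqs1 : M ^ η < (q : ℝ) ^ (s + 1) := by
      have := Nat.lt_of_floor_lt (Nat.lt_pow_succ_log_self hq.one_lt ⌊M ^ η⌋₊)
      exact_mod_cast this
    have hq0 : (0 : ℝ) < q := by exact_mod_cast hq.pos
    have hYq : M ^ (η / (s + 1)) < q := by
      have hs1 : (0 : ℝ) < s + 1 := by positivity
      have h1 := Real.log_lt_log (by positivity) hqs1
      rw [Real.log_rpow hM0, Real.log_pow] at h1
      rw [← Real.log_lt_log_iff (by positivity) hq0, Real.log_rpow hM0, div_mul_eq_mul_div,
        div_lt_iff₀ hs1]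
      push_cast at h1
      linarith
    have hdp' : ∀ p : ℕ, p.Prime → p ∣ d → M ^ (η / (s + 1)) < p := fun p hp hpd =>
      hYq.trans_le (by exact_mod_cast hdp p hp hpd)
    refine ⟨s, ?_, b, d, hcd, hcop, hb0, hd0, hbX, fun _ => hbl, fun p hp hpb => ?_, hdp',
      hΩ s d hd0 (Dvd.intro_left _ hcd.symm) hdp'⟩
    · have h1 := Real.log_le_log (by positivity) hqs
      rw [Real.log_pow, Real.log_rpow hM0] at h1
      refine le_trans (mul_le_mul_of_nonneg_left ?_ (Nat.cast_nonneg s)) h1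
      exact Real.log_le_log hQ0 (by exact_mod_cast hqQ.le)
    · refine le_trans ?_ hqs
      have := (lt_of_prime_dvd_primePartBelow hp hpb).le
      gcongr

/-- The upper bound for a single value of `T`. -/
theorem exists_sum_le_main {θ ξ κ lam₁ lam₂ B K L₁ L₂ α Btilde A : ℝ} (hθ : 0 < θ) (hξ : 0 < ξ)
    (hθ1 : θ < 1) (hlam₁ : 0 < lam₁) (hlam₂ : 0 < lam₂) (hB : 0 < B)
    (hL₁ : 0 < L₁) (hL₂ : 0 < L₂) (hα : 0 < α) (hBtilde : 0 < Btilde) (hA : 1 ≤ A)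
    {f : ArithmeticFunction ℝ}
    (hf : ∀ ε : ℝ, 0 < ε → ∃ C : ℝ, 0 < C ∧ IsSubmultClass A ε C f) :
    ∃ C₀ : ℝ, 0 < C₀ ∧ ∀ {𝒜 : Type*} (S : Finset 𝒜) (χ : 𝒜 → ℝ) (c : 𝒜 → ℕ) (M : ℝ)
      (h : ArithmeticFunction ℝ), IsDensityFunction κ lam₁ lam₂ B K h →
      IsEquidistributedAt θ ξ B L₁ L₂ S χ c M h → (∀ a ∈ S, 0 < c a) →
      (∀ a ∈ S, (c a : ℝ) ≤ Btilde * M ^ α) →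
      ∑ a ∈ S, χ a * f (c a) ≤
        C₀ * (M * sieveProduct B M h * ∑ n ∈ Finset.Icc 1 ⌊M⌋₊, f n * h n) := by
  obtain ⟨δ, hδ0, hδ1, Cb, hCb, hbad⟩ := exists_sum_prime_pow_dvd_le (θ := θ) (ξ := ξ) (κ := κ)
    (K := K) hB hlam₁ hlam₂ hL₁ hL₂
  set x : ℝ := min θ ξ / 8 with hxdef
  have hx : 0 < x := by have := lt_min hθ hξ; positivity
  have hxθ : 8 * x ≤ θ := by have := min_le_left θ ξ; linarith
  have hxξ : 8 * x ≤ ξ := by have := min_le_right θ ξ; linarith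
  set η : ℝ := δ * x / 8 with hηdef
  have hη : 0 < η := by positivity
  have hηx : 8 * η ≤ x := by rw [hηdef]; nlinarith
  obtain ⟨Q₀, hQ₀, Cc, hCc, hcls⟩ := exists_sum_class_le (θ := θ) (ξ := ξ) (κ := κ) (K := K) hB
    hlam₁ hlam₂ hL₁ hL₂ hA hx (by linarith) hη (by linarith) (by linarith) ⌈(α + 1) / η⌉₊ hf
  have hQ0 : (2 : ℝ) ≤ Q₀ := by exact_mod_cast hQ₀
  -- A power of `M` saved in every error term: the least saving, `M ^ (-4 * τ)`, comes from the
  -- powers of primes up to `Q₀`.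
  set τ : ℝ := δ * x / (8 * Q₀) with hτdef
  have hτ : 0 < τ := by positivity
  have hτQ : δ * x / (2 * Q₀) = 4 * τ := by rw [hτdef]; field_simp; norm_num
  have hτη : 2 * τ ≤ η := by
    have : η = τ * Q₀ := by rw [hτdef, hηdef]; field_simp
    nlinarith
  obtain ⟨CE, hCE, hmain⟩ := exists_rpow_le_main (κ := κ) (lam₁ := lam₁) (lam₂ := lam₂) (K := K)
    hB hτ hf
  obtain ⟨CE1, hCE1, hmain1⟩ := exists_rpow_le_main (κ := κ) (lam₁ := lam₁) (lam₂ := lam₂)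
    (K := K) hB one_pos hf
  obtain ⟨Cε, hCε, hfε⟩ := hf (τ / (α + 1)) (by positivity)
  obtain ⟨Cf, hCf, hf1⟩ := hf 1 one_pos
  set M₀ : ℝ := 2 + Btilde + (Q₀ : ℝ) ^ (1 / x) with hM₀
  have hM₀2 : 0 < M₀ := by positivity
  set C₁ : ℝ := 2 * (Cc + Cc * CE) + Cε * (Cb + L₂) * CE + Cε * Q₀ * (Cb + L₂) * CE with hC₁
  set C₂ : ℝ := (1 + L₁ + L₂) * M₀ * (Cf * (Btilde * M₀ ^ α)) * CE1 with hC₂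
  refine ⟨C₁ + C₂, by positivity, fun {𝒜} S χ c M h hh hE hc hcM => ?_⟩
  have hM1 := hE.one_le
  have hM0 : 0 < M := by linarith
  have hf0 := hf1.nonneg 1
  set F := M * sieveProduct B M h * ∑ n ∈ Finset.Icc 1 ⌊M⌋₊, f n * h n with hF
  have hF0 : 0 ≤ F := mul_nonneg (mul_nonneg hM0.le
    (hh.prod_one_sub_pos hB fun p hp => (Finset.mem_filter.1 hp).2).le)
    (Finset.sum_nonneg fun n _ => mul_nonneg (hf1.nonneg n) (hh.nonneg n))
  have hfle : ∀ {ε C : ℝ}, IsSubmultClass A ε C f → ∀ a ∈ S, f (c a) ≤ f 1 * (C * (c a : ℝ) ^ ε) :=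
    fun hfC a ha => by
      have := hfC.mul_le 1 (c a) one_pos (hc a ha) (Nat.coprime_one_left _)
      rw [one_mul] at this
      exact this.trans (mul_le_mul_of_nonneg_left (min_le_right _ _) hf0)
  rcases lt_or_ge M M₀ with hsmall | hlarge
  -- For bounded `M` both sides are of the order of `f 1`.
  · have h1 : ∀ a ∈ S, χ a * f (c a) ≤ χ a * (f 1 * (Cf * (Btilde * M₀ ^ α))) := fun a ha => by
      refine mul_le_mul_of_nonneg_left ((hfle hf1 a ha).trans ?_) (hE.nonneg a ha)
      rw [Real.rpow_one]
      have : (c a : ℝ) ≤ Btilde * M₀ ^ α := (hcM a ha).trans (by gcongr)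
      gcongr
    have h2 := hmain1 h hh M hM1
    rw [sub_self, Real.rpow_zero, mul_one] at h2
    have h3 : ∑ a ∈ S, χ a ≤ (1 + L₁ + L₂) * M₀ :=
      (sum_weight_le hθ hξ hB hL₁ hL₂ hh hE).trans (by gcongr)
    calc ∑ a ∈ S, χ a * f (c a) ≤ ∑ a ∈ S, χ a * (f 1 * (Cf * (Btilde * M₀ ^ α))) :=
          Finset.sum_le_sum h1
      _ = (∑ a ∈ S, χ a) * (f 1 * (Cf * (Btilde * M₀ ^ α))) := by rw [Finset.sum_mul]
      _ ≤ ((1 + L₁ + L₂) * M₀) * ((CE1 * F) * (Cf * (Btilde * M₀ ^ α))) := by gcongr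
      _ = C₂ * F := by rw [hC₂]; ring
      _ ≤ (C₁ + C₂) * F := by
          have : 0 ≤ C₁ * F := by positivity
          linarith
  have hQpow : 0 < (Q₀ : ℝ) ^ (1 / x) := by positivity
  have hM2 : 2 ≤ M := by linarith
  have hMB : Btilde ≤ M := by linarith
  have hQM : (Q₀ : ℝ) ≤ M ^ x := by
    have h1 : (Q₀ : ℝ) ^ (1 / x) ≤ M := by linarith
    have h2 := Real.rpow_le_rpow hQpow.le h1 hx.le
    rwa [← Real.rpow_mul (by linarith), one_div_mul_cancel hx.ne', Real.rpow_one] at h2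
  have hmono : ∀ {u v : ℝ}, u ≤ v → M ^ u ≤ M ^ v := fun huv =>
    Real.rpow_le_rpow_of_exponent_le hM1 huv
  have hcM' : ∀ a ∈ S, (c a : ℝ) ≤ M ^ (α + 1) := fun a ha => by
    rw [Real.rpow_add_one hM0.ne', mul_comm]
    exact (hcM a ha).trans (by gcongr)
  have hfτ : ∀ a ∈ S, f (c a) ≤ f 1 * (Cε * M ^ τ) := fun a ha => by
    refine (hfle hfε a ha).trans ?_
    have : (c a : ℝ) ^ (τ / (α + 1)) ≤ M ^ τ := by
      refine (Real.rpow_le_rpow (Nat.cast_nonneg _) (hcM' a ha) (by positivity)).trans (le_of_eq ?_)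
      rw [← Real.rpow_mul hM0.le]; congr 1; field_simp
    gcongr
  have hfnn : ∀ a ∈ S, 0 ≤ χ a * f (c a) := fun a ha => mul_nonneg (hE.nonneg a ha) (hf1.nonneg _)
  have hEmain := hmain h hh M hM1
  classical
  set S₁ := S.filter (fun a => ∃ p v : ℕ, p.Prime ∧ p ≤ ⌊M ^ η⌋₊ ∧ p ^ v ∣ c a ∧
    M ^ (x / 2) < ((p ^ v : ℕ) : ℝ)) with hS₁
  set S₂ := S.filter (fun a => ∃ p v : ℕ, p.Prime ∧ p ≤ Q₀ ∧ p ^ v ∣ c a ∧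
    M ^ (x / (2 * Q₀)) < ((p ^ v : ℕ) : ℝ)) with hS₂
  set S₃ : ℕ → Finset 𝒜 := fun s => S.filter (fun a => ∃ b d : ℕ, c a = b * d ∧ b.Coprime d ∧
      0 < b ∧ 0 < d ∧ (b : ℝ) ≤ M ^ x ∧ (s ≠ 0 → M ^ (x / 2) < b) ∧
      (∀ p : ℕ, p.Prime → p ∣ b → (p : ℝ) ^ s ≤ M ^ η) ∧
      (∀ p : ℕ, p.Prime → p ∣ d → M ^ (η / (s + 1)) < p) ∧ Ω d ≤ ⌈(α + 1) / η⌉₊ * (s + 1)) with hS₃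
  have hlogQ : 0 < Real.log Q₀ := Real.log_pos (by linarith)
  set I := (Finset.range (⌊η * Real.log M / Real.log Q₀⌋₊ + 1)) with hI
  have hIs : ∀ s : ℕ, s ∈ I ↔ s * Real.log Q₀ ≤ η * Real.log M := fun s => by
    have : 0 ≤ η * Real.log M / Real.log Q₀ := by
      have := Real.log_nonneg hM1
      positivity
    rw [hI, Finset.mem_range, Nat.lt_succ_iff, Nat.le_floor_iff this, le_div_iff₀ hlogQ]
  have hcover : S ⊆ S₁ ∪ (S₂ ∪ I.biUnion S₃) := by
    intro a ha
    rcases exists_prime_pow_or_class hx hη (by linarith : 1 < M) hQ₀ (hc a ha) (hcM' a ha)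
      with h1 | h1 | ⟨s, hs, h1⟩
    · exact Finset.mem_union_left _ (Finset.mem_filter.2 ⟨ha, h1⟩)
    · exact Finset.mem_union_right _ (Finset.mem_union_left _ (Finset.mem_filter.2 ⟨ha, h1⟩))
    · exact Finset.mem_union_right _ (Finset.mem_union_right _
        (Finset.mem_biUnion.2 ⟨s, (hIs s).2 hs, Finset.mem_filter.2 ⟨ha, h1⟩⟩))
  have hsplit : ∑ a ∈ S, χ a * f (c a) ≤ ∑ a ∈ S₁, χ a * f (c a) + (∑ a ∈ S₂, χ a * f (c a) +
      ∑ s ∈ I, ∑ a ∈ S₃ s, χ a * f (c a)) := by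
    have hunion : ∀ U V : Finset 𝒜, U ⊆ S → ∑ a ∈ U ∪ V, χ a * f (c a) ≤
        ∑ a ∈ U, χ a * f (c a) + ∑ a ∈ V, χ a * f (c a) := fun U V hU => by
      rw [← Finset.sum_union_inter]
      exact le_add_of_nonneg_right (Finset.sum_nonneg fun a ha =>
        hfnn a (hU (Finset.mem_inter.1 ha).1))
    have hbiUnion : ∀ J : Finset ℕ, ∑ a ∈ J.biUnion S₃, χ a * f (c a) ≤
        ∑ s ∈ J, ∑ a ∈ S₃ s, χ a * f (c a) := fun J => by
      induction J using Finset.induction_on with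
      | empty => simp
      | insert s J hs ih =>
        rw [Finset.biUnion_insert, Finset.sum_insert hs]
        exact (hunion _ _ (Finset.filter_subset _ _)).trans (by gcongr)
    have hsub : S₁ ∪ (S₂ ∪ I.biUnion S₃) ⊆ S := Finset.union_subset (Finset.filter_subset _ _)
      (Finset.union_subset (Finset.filter_subset _ _)
        (Finset.biUnion_subset.2 fun s _ => Finset.filter_subset _ _))
    calc ∑ a ∈ S, χ a * f (c a) ≤ ∑ a ∈ S₁ ∪ (S₂ ∪ I.biUnion S₃), χ a * f (c a) :=
          Finset.sum_le_sum_of_subset_of_nonneg hcover fun a ha _ => hfnn a (hsub ha)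
      _ ≤ _ := (hunion _ _ (Finset.filter_subset _ _)).trans (add_le_add_right
          ((hunion _ _ (Finset.filter_subset _ _)).trans (add_le_add_right (hbiUnion I) _)) _)
  -- Large powers of primes up to `M ^ η`.
  have hpart : ∀ S' ⊆ S, ∑ a ∈ S', χ a * f (c a) ≤ (∑ a ∈ S', χ a) * (f 1 * (Cε * M ^ τ)) :=
    fun S' hS' => by
      rw [Finset.sum_mul]
      exact Finset.sum_le_sum fun a ha =>
        mul_le_mul_of_nonneg_left (hfτ a (hS' ha)) (hE.nonneg a (hS' ha))
  have hbound₁ : ∑ a ∈ S₁, χ a * f (c a) ≤ Cε * (Cb + L₂) * CE * F := by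
    have hfl : ((⌊M ^ η⌋₊ : ℕ) : ℝ) ≤ M ^ η := Nat.floor_le (by positivity)
    have h1 := hbad S χ c M h hh hE ⌊M ^ η⌋₊ (M ^ (x / 2)) (Real.one_le_rpow hM1 (by positivity))
      (by
        calc _ ≤ M ^ η * M ^ (x / 2) := by gcongr
          _ = M ^ (η + x / 2) := (Real.rpow_add hM0 _ _).symm
          _ ≤ M ^ θ := hmono (by linarith)) S₁ (Finset.filter_subset _ _)
      fun a ha => (Finset.mem_filter.1 ha).2
    have h2 : (M ^ (x / 2)) ^ (-δ) * M = M ^ (1 - 4 * η) := by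
      rw [← Real.rpow_mul hM0.le, ← Real.rpow_add_one hM0.ne', hηdef]; congr 1; ring
    have h3 : Cb * (M ^ (x / 2)) ^ (-δ) * M + L₂ * M ^ (1 - ξ) ≤ (Cb + L₂) * M ^ (1 - 4 * η) := by
      rw [mul_assoc, h2, add_mul]
      have := hmono (show 1 - ξ ≤ 1 - 4 * η by linarith)
      gcongr
    calc ∑ a ∈ S₁, χ a * f (c a) ≤ (∑ a ∈ S₁, χ a) * (f 1 * (Cε * M ^ τ)) :=
          hpart S₁ (Finset.filter_subset _ _)
      _ ≤ (M ^ η * ((Cb + L₂) * M ^ (1 - 4 * η))) * (f 1 * (Cε * M ^ τ)) := by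
          gcongr
          exact h1.trans (by gcongr)
      _ = Cε * (Cb + L₂) * (f 1 * M ^ (η + (1 - 4 * η) + τ)) := by
          rw [Real.rpow_add hM0, Real.rpow_add hM0]; ring
      _ ≤ Cε * (Cb + L₂) * (f 1 * M ^ (1 - τ)) := by
          have := hmono (show η + (1 - 4 * η) + τ ≤ 1 - τ by linarith)
          gcongr
      _ ≤ Cε * (Cb + L₂) * (CE * F) := by gcongr
      _ = _ := by ring
  have hbound₂ : ∑ a ∈ S₂, χ a * f (c a) ≤ Cε * Q₀ * (Cb + L₂) * CE * F := by
    have h1 := hbad S χ c M h hh hE Q₀ (M ^ (x / (2 * Q₀))) (Real.one_le_rpow hM1 (by positivity))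
      (by
        calc _ ≤ M ^ x * M ^ (x / (2 * Q₀)) := by gcongr
          _ = M ^ (x + x / (2 * Q₀)) := (Real.rpow_add hM0 _ _).symm
          _ ≤ M ^ θ := hmono (by
            have : x / (2 * Q₀) ≤ x := div_le_self hx.le (by linarith)
            linarith)) S₂ (Finset.filter_subset _ _)
      fun a ha => (Finset.mem_filter.1 ha).2
    have h2 : (M ^ (x / (2 * Q₀))) ^ (-δ) * M = M ^ (1 - 4 * τ) := by
      rw [← Real.rpow_mul hM0.le, ← Real.rpow_add_one hM0.ne', ← hτQ]; congr 1; ring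
    have h3 : Cb * (M ^ (x / (2 * Q₀))) ^ (-δ) * M + L₂ * M ^ (1 - ξ) ≤
        (Cb + L₂) * M ^ (1 - 4 * τ) := by
      rw [mul_assoc, h2, add_mul]
      have := hmono (show 1 - ξ ≤ 1 - 4 * τ by linarith)
      gcongr
    calc ∑ a ∈ S₂, χ a * f (c a) ≤ (∑ a ∈ S₂, χ a) * (f 1 * (Cε * M ^ τ)) :=
          hpart S₂ (Finset.filter_subset _ _)
      _ ≤ (Q₀ * ((Cb + L₂) * M ^ (1 - 4 * τ))) * (f 1 * (Cε * M ^ τ)) := by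
          gcongr
          exact h1.trans (by gcongr)
      _ = Cε * Q₀ * (Cb + L₂) * (f 1 * M ^ (1 - 4 * τ + τ)) := by
          rw [Real.rpow_add hM0]; ring
      _ ≤ Cε * Q₀ * (Cb + L₂) * (f 1 * M ^ (1 - τ)) := by
          have := hmono (show 1 - 4 * τ + τ ≤ 1 - τ by linarith)
          gcongr
      _ ≤ Cε * Q₀ * (Cb + L₂) * (CE * F) := by gcongr
      _ = _ := by ring
  have hbound₃ : ∑ s ∈ I, ∑ a ∈ S₃ s, χ a * f (c a) ≤ 2 * (Cc + Cc * CE) * F := by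
    have h1 : ∀ s ∈ I, ∑ a ∈ S₃ s, χ a * f (c a) ≤ (1 / 2) ^ s * ((Cc + Cc * CE) * F) := by
      intro s hs
      refine (hcls S χ c M h hh hE hM2 s ((hIs s).1 hs) (S₃ s) (Finset.filter_subset _ _)
        fun a ha => (Finset.mem_filter.1 ha).2).trans ?_
      refine mul_le_mul_of_nonneg_left ?_ (by positivity)
      have h2 := hmono (show 1 - ξ + 3 * x + 4 * η ≤ 1 - τ by linarith)
      have h3 : f 1 * M ^ (1 - ξ + 3 * x + 4 * η) ≤ CE * F :=
        (mul_le_mul_of_nonneg_left h2 hf0).trans hEmain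
      have h4 := mul_le_mul_of_nonneg_left h3 hCc.le
      linarith
    refine (Finset.sum_le_sum h1).trans ?_
    rw [← Finset.sum_mul]
    have h5 := sum_geometric_two_le (⌊η * Real.log M / Real.log Q₀⌋₊ + 1)
    have h6 := mul_le_mul_of_nonneg_right h5 (show 0 ≤ (Cc + Cc * CE) * F by positivity)
    linarith
  have hC₂F : 0 ≤ C₂ * F := by positivity
  have : (C₁ + C₂) * F = Cε * (Cb + L₂) * CE * F + (Cε * Q₀ * (Cb + L₂) * CE * F +
    2 * (Cc + Cc * CE) * F) + C₂ * F := by rw [hC₁]; ring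
  linarith

theorem theorem1p1
    (θ ξ κ lam₁ lam₂ B K : ℝ) (hθ : 0 < θ) (hξ : 0 < ξ) (hθξ : max θ ξ < 1)
    (hκ : 0 < κ) (hlam₁ : 0 < lam₁) (hlam₂ : 0 < lam₂) (hB : 0 < B) (hK : 0 < K)
    (L₁ L₂ : ℝ) (hL₁ : 0 < L₁) (hL₂ : 0 < L₂)
    (α Btilde : ℝ) (hα : 0 < α) (hBtilde : 0 < Btilde)
    (A : ℝ) (hA : 1 < A) (f : ArithmeticFunction ℝ)
    (hf : ∀ ε : ℝ, 0 < ε → ∃ C : ℝ, 0 < C ∧ IsSubmultClass A ε C f) :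
    ∃ C₀ : ℝ, 0 < C₀ ∧
      ∀ (𝒜 : Type*) [Infinite 𝒜] (χ : ℝ → 𝒜 → ℝ) (c : 𝒜 → ℕ)
        (M : ℝ → ℝ) (h : ℝ → ArithmeticFunction ℝ),
        IsWeightFamily χ →
        (∀ a, 0 < c a) →
        IsEquidistributed θ ξ κ lam₁ lam₂ B K L₁ L₂ χ c M h →
        (∀ T : ℝ, 1 ≤ T → ∀ a, 0 < χ T a → (c a : ℝ) ≤ Btilde * M T ^ α) →
        ∀ T : ℝ, 1 ≤ T →
          ∑ᶠ a, χ T a * f (c a) ≤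
            C₀ * (M T * (∏ p ∈ (Finset.Icc 1 ⌊M T⌋₊).filter (fun p : ℕ => p.Prime ∧ B < (p : ℝ)), (1 - h T p)) *
              ∑ n ∈ Finset.Icc 1 ⌊M T⌋₊, f n * h T n) := by
  obtain ⟨C₀, hC₀, hmain⟩ := exists_sum_le_main (κ := κ) (K := K) hθ hξ
    ((le_max_left θ ξ).trans_lt hθξ) hlam₁ hlam₂ hB hL₁ hL₂ hα hBtilde hA.le hf
  refine ⟨C₀, hC₀, fun 𝒜 _ χ c M h hχ hc hE hcM T hT => ?_⟩
  set S := (hχ.finite T hT).toFinset with hS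
  have hmem : ∀ a, a ∈ S ↔ 0 < χ T a := fun a => by simp [hS]
  have hsupp : ∀ a, χ T a ≠ 0 → a ∈ S := fun a ha =>
    (hmem a).2 (lt_of_le_of_ne (hχ.nonneg T hT a) (Ne.symm ha))
  have hsum : ∑ᶠ a, χ T a * f (c a) = ∑ a ∈ S, χ T a * f (c a) :=
    finsum_eq_sum_of_support_subset _ fun a ha => hsupp a fun h0 => ha (by simp [h0])
  have hcong : ∀ d, congruenceSum χ c d T = ∑ a ∈ S.filter (fun a => d ∣ c a), χ T a := fun d => by
    refine finsum_mem_eq_sum_of_inter_support_eq _ (Set.ext fun a => ?_)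
    simp only [Set.mem_inter_iff, Set.mem_ofPred_eq, Function.mem_support, Finset.coe_filter]
    exact ⟨fun ⟨h1, h2⟩ => ⟨⟨hsupp a h2, h1⟩, h2⟩, fun ⟨⟨_, h1⟩, h2⟩ => ⟨h1, h2⟩⟩
  rw [hsum]
  refine hmain S (χ T) c (M T) (h T) (hE.density T hT) ⟨hE.one_le T hT,
    fun a _ => hχ.nonneg T hT a, fun d hd hdM => ?_⟩ (fun a _ => hc a)
    fun a ha => hcM T hT a ((hmem a).1 ha)
  rw [← hcong d]
  exact hE.congruence T hT d hd hdM
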